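/- Let $n\in\mathbb N$, $t>0$, and let $q_s(y)=(4\pi s)^{-n/2}e^{-|y|^2/(4s)}$ be the heat kernel on $\mathbb R^n$; we use the same symbol for its entire extension $q_s(z)=(4\pi s)^{-n/2}e^{-(z_1^2+\dots+z_n^2)/(4s)}$ to $\mathbb C^n$. Let $\mathcal B_t(\mathbb C^n)$ be the Hilbert space of entire functions on $\mathbb C^n$ that are square integrable with respect to $q_{t/2}(y)\,dx\,dy$ ($z=x+iy$), and let $\mathcal F(\mathbb C^n)$ be the Fock space of entire functions that are square integrable with respect to $(2\pi)^{-n}e^{-|z|^2/2}\,dx\,dy$. Let $g_0:\mathbb R^n\to\mathbb C$ be Lebesgue measurable and $g(x+iy)=g_0(y)$. If $\mathcal H$ is one of these two spaces, $L^2$ the corresponding weighted $L^2$-space on $\mathbb C^n$, and $\mathcal D\subseteq\mathcal H$ a dense linear subspace (possibly $\mathcal D=\mathcal H$) such that $gF\in L^2$ for all $F\in\mathcal D$, the Toeplitz operator $T_g:\mathcal D\to\mathcal H$ is $T_gF=P(gF)$, where $P:L^2\to\mathcal H$ is the orthogonal projection; it is called bounded if $\|T_gF\|\le C\|F\|$ for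 some constant $C$ and all $F\in\mathcal D$. **Theorem 2.4 (symbols depending only on $y$).** (a) The Segal–Bargmann transform $U f(z)=\int_{\mathbb R^n} f(u)\,q_t(z-u)\,du$ is a unitary map of $L^2(\mathbb R^n)$ onto $\mathcal B_t(\mathbb C^n)$. For every $\mathcal D\subseteq\mathcal B_t(\mathbb C^n)$ as above, the integral defining $g_0*q_{t/2}(\xi)$ converges absolutely for every $\xi\in\mathbb R^n$, and $T_g$ is bounded if and only if $g_0*q_{t/2}$ is a bounded function on $\mathbb R^n$. In that case $T_g$ extends to a bounded operator on $\mathcal B_t(\mathbb C^n)$, and $U^{-1}T_gU$ is the Fourier multiplier on $L^2(\mathbb R^n)$ with $$m_t(\xi)=(g_0*q_{t/2})(-2t\xi),$$ that is, $(U^{-1}T_gUf)^\wedge(\xi)=m_t(\xi)\hat f(\xi)$ for almost every $\xi$ and all $f\in L^2(\mathbb R^n)$, where $\hat f(\xi)=(2\pi)^{-n/2}\int f(x)e^{-ix\cdot\xi}\,dx$. (b) (Berger–Coburn conjecture for this class of symbols.) For every $\mathcal D\subseteq\mathcal F(\mathbb C^n)$ as above, the convolution on $\mathbb C^n=\mathbb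 R^{2n}$ of $g$ with the heat kernel $(4\pi s)^{-n}e^{-|z|^2/(4s)}$ at $s=1/4$ converges absolutely everywhere, and $T_g$ is bounded on $\mathcal F(\mathbb C^n)$ if and only if this convolution is a bounded function on $\mathbb C^n$. -/

import Mathlib

open MeasureTheory Filter Topology Metric
open scoped FourierTransform

/-! ### Entire functions on `ℂⁿ`: helper facts for the closedness of weighted Bergman spaces

`ℂⁿ` is modelled by `Fin n → ℂ` with Lebesgue measure `volume` (that is, `dx dy`), and `ℝⁿ` by
`EuclideanSpace ℝ (Fin n)`. An entire function is a map `F` with `Differentiable ℂ F`. -/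

theorem exists_entire_limit {E : Type*} [NormedAddCommGroup E] [NormedSpace ℂ E]
    (u : ℕ → E → ℂ) (hu : ∀ k, Differentiable ℂ (u k))
    (hc : ∀ R : ℝ, UniformCauchySeqOn u atTop (closedBall (0 : E) R)) :
    ∃ F : E → ℂ, Differentiable ℂ F ∧ ∀ z, Tendsto (fun k => u k z) atTop (𝓝 (F z)) := by
  have hlim : ∀ z, ∃ a, Tendsto (fun k => u k z) atTop (𝓝 a) := fun z =>
    cauchySeq_tendsto_of_complete ((hc ‖z‖).cauchySeq (by simp))
  choose F hF using hlim
  have hd : ∀ R : ℝ, UniformCauchySeqOn (fun k => fderiv ℂ (u k)) atTop (ball (0 : E) R) := by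
    intro R
    rw [Metric.uniformCauchySeqOn_iff]
    intro ε hε
    obtain ⟨N, hN⟩ := Metric.uniformCauchySeqOn_iff.1 (hc (R + 1)) (ε / 4) (by positivity)
    refine ⟨N, fun k hk l hl z hz => ?_⟩
    have hz' : ‖z‖ < R := by simpa using hz
    have hdiff : Differentiable ℂ (fun w => u k w - u l w) := (hu k).sub (hu l)
    have hs : ∀ w ∈ ball z 1, ‖u k w - u l w‖ ≤ ε / 4 := by
      intro w hw
      have : ‖w - z‖ < 1 := by simpa [dist_eq_norm] using hw
      have hw' : ‖w‖ ≤ R + 1 := by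
        have := norm_le_norm_add_norm_sub' w z
        linarith
      have := hN k hk l hl w (by simpa using hw')
      rw [dist_eq_norm] at this
      exact this.le
    have hb := Complex.norm_fderiv_le_div_of_mapsTo_ball (f := fun w => u k w - u l w)
      (c := z) (R₁ := 1) (R₂ := ε / 2) hdiff.differentiableOn (by
        intro w hw
        have h1 := hs w hw
        have h2 := hs z (by simp)
        simp only [mem_closedBall, dist_eq_norm]
        have := norm_sub_le (u k w - u l w) (u k z - u l z)
        linarith) one_pos
    rw [fderiv_fun_sub (hu k z) (hu l z)] at hb
    rw [dist_eq_norm]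
    linarith
  have hlim' : ∀ z, ∃ a, Tendsto (fun k => fderiv ℂ (u k) z) atTop (𝓝 a) := fun z =>
    cauchySeq_tendsto_of_complete ((hd (‖z‖ + 1)).cauchySeq (by simp))
  choose G hG using hlim'
  refine ⟨F, fun z => ?_, hF⟩
  have := hasFDerivAt_of_tendstoUniformlyOn (s := ball (0 : E) (‖z‖ + 1)) isOpen_ball
    ((hd (‖z‖ + 1)).tendstoUniformlyOn_of_tendsto fun w _ => hG w)
    (fun k w _ => (hu k w).hasFDerivAt) (fun w _ => hF w) (x := z) (by simp)
  exact this.differentiableAt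

theorem measurePreserving_smul_unit {n : ℕ} (c : ℂ) (hc : ‖c‖ = 1) :
    MeasurePreserving (fun z : Fin n → ℂ => c • z) := by
  have h : MeasurePreserving (fun z : ℂ => c * z) := by
    have := (rotation (⟨c, by simpa [Submonoid.unitSphere] using hc⟩ : Circle)).measurePreserving
    convert this using 2
    rfl
  exact volume_preserving_pi (fun _ : Fin n => h)

theorem integral_closedBall_entire {n : ℕ} (F : (Fin n → ℂ) → ℂ) (hF : Differentiable ℂ F)
    (z : Fin n → ℂ) :
    ∫ v in closedBall (0 : Fin n → ℂ) 1, F (z + v)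
      = (volume.real (closedBall (0 : Fin n → ℂ) 1) : ℂ) * F z := by
  set B := closedBall (0 : Fin n → ℂ) 1 with hB
  have hrot : ∀ θ : ℝ, ∫ v in B, F (z + circleMap 0 1 θ • v) = ∫ v in B, F (z + v) := by
    intro θ
    have hc : ‖circleMap 0 1 θ‖ = 1 := by simp
    have hc0 : circleMap 0 1 θ ≠ 0 := by
      intro h; simp [h] at hc
    have hmp := measurePreserving_smul_unit (n := n) _ hc
    have hpre : (fun v : Fin n → ℂ => circleMap 0 1 θ • v) ⁻¹' B = B := by
      ext v
      simp only [hB, Set.mem_preimage, mem_closedBall, dist_zero_right, norm_smul, hc, one_mul]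
    have := hmp.setIntegral_preimage_emb
      ((Homeomorph.smulOfNeZero _ hc0).measurableEmbedding) (fun v => F (z + v)) B
    rw [hpre] at this
    exact this
  have hmean : ∀ v, ∫ θ in (0)..(2 * Real.pi), F (z + circleMap 0 1 θ • v)
      = (2 * Real.pi : ℝ) • F z := by
    intro v
    have hd : Differentiable ℂ (fun c : ℂ => F (z + c • v)) :=
      hF.comp ((differentiable_const z).add (differentiable_id.smul_const v))
    have := circleAverage_of_differentiable_on_off_countable (c := 0) (R := 1)
      (f := fun c : ℂ => F (z + c • v)) Set.countable_empty hd.continuous.continuousOn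
      (fun x _ => hd x)
    rw [Real.circleAverage_def, inv_smul_eq_iff₀ (by positivity)] at this
    simpa using this
  have hcont : Continuous (fun p : (Fin n → ℂ) × ℝ => F (z + circleMap 0 1 p.2 • p.1)) := by
    have : Continuous (circleMap 0 1) := continuous_circleMap 0 1
    exact hF.continuous.comp (by fun_prop)
  have hswap : ∫ v in B, ∫ θ in (0)..(2 * Real.pi), F (z + circleMap 0 1 θ • v)
      = ∫ θ in (0)..(2 * Real.pi), ∫ v in B, F (z + circleMap 0 1 θ • v) := by
    simp only [intervalIntegral.integral_of_le (by positivity : (0:ℝ) ≤ 2 * Real.pi)]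
    apply integral_integral_swap
    rw [Measure.prod_restrict]
    have hK : IsCompact (B ×ˢ Set.Icc (0 : ℝ) (2 * Real.pi)) :=
      (isCompact_closedBall _ _).prod isCompact_Icc
    exact (hcont.continuousOn.integrableOn_compact hK).mono_set
      (Set.prod_mono le_rfl Set.Ioc_subset_Icc_self)
  simp only [hmean, hrot] at hswap
  simp only [integral_const, intervalIntegral.integral_const, sub_zero] at hswap
  have hpi : (2 * Real.pi : ℂ) ≠ 0 := by simp [Real.pi_ne_zero]
  have h3 : (2 * Real.pi : ℂ) * ∫ v in B, F (z + v)
      = (2 * Real.pi : ℂ) * ((volume.real B : ℂ) * F z) := by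
    simp only [Complex.real_smul, measureReal_restrict_apply_univ] at hswap
    push_cast at hswap
    rw [← hswap]; ring
  exact mul_left_cancel₀ hpi h3

/-- A continuous strictly positive weight on `ℂⁿ`. -/
structure BergmanWeight (n : ℕ) where
  toFun : (Fin n → ℂ) → ℝ
  continuous_toFun : Continuous toFun
  pos_toFun : ∀ z, 0 < toFun z

namespace BergmanWeight
variable {n : ℕ}

/-- The measure `w(z) dz`. -/
noncomputable def measure (w : BergmanWeight n) : Measure (Fin n → ℂ) :=
  volume.withDensity fun z => ENNReal.ofReal (w.toFun z)

theorem norm_entire_le (w : BergmanWeight n) (R : ℝ) :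
    ∃ C : ℝ, ∀ F : (Fin n → ℂ) → ℂ, Differentiable ℂ F → MemLp F 2 w.measure →
      ∀ z ∈ closedBall (0 : Fin n → ℂ) R, ‖F z‖ ≤ C * (eLpNorm F 2 w.measure).toReal := by
  rcases lt_or_ge R 0 with hR | hR
  · exact ⟨0, fun F _ _ z hz => by simp [closedBall_eq_empty.2 hR] at hz⟩
  set B := closedBall (0 : Fin n → ℂ) 1 with hB
  set K := closedBall (0 : Fin n → ℂ) (R + 1) with hK
  have hKc : IsCompact K := isCompact_closedBall _ _
  obtain ⟨z₀, -, hz₀⟩ := hKc.exists_isMinOn ⟨0, by simp [hK]; linarith⟩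
    w.continuous_toFun.continuousOn
  set δ := w.toFun z₀ with hδ
  have hδ0 : 0 < δ := w.pos_toFun z₀
  have hle : (volume.restrict K : Measure (Fin n → ℂ)) ≤ ENNReal.ofReal δ⁻¹ • w.measure := by
    rw [Measure.le_iff]
    intro s hs
    have hsK : MeasurableSet (s ∩ K) := hs.inter hKc.measurableSet
    rw [Measure.restrict_apply hs, Measure.smul_apply, smul_eq_mul]
    calc volume (s ∩ K) = ∫⁻ _ in s ∩ K, 1 := by simp
      _ ≤ ∫⁻ z in s ∩ K, ENNReal.ofReal δ⁻¹ * ENNReal.ofReal (w.toFun z) := by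
          refine setLIntegral_mono' hsK fun z hz => ?_
          have hz' : δ ≤ w.toFun z := hz₀ hz.2
          rw [← ENNReal.ofReal_mul (by positivity), ← ENNReal.ofReal_one]
          apply ENNReal.ofReal_le_ofReal
          rw [inv_mul_eq_div, le_div_iff₀ hδ0, one_mul]
          exact hz'
      _ = ENNReal.ofReal δ⁻¹ * w.measure (s ∩ K) := by
          rw [lintegral_const_mul _ w.continuous_toFun.measurable.ennreal_ofReal,
            measure, withDensity_apply _ hsK]
      _ ≤ _ := by gcongr; exact Set.inter_subset_left
  have hB0 : 0 < volume.real B := by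
    rw [measureReal_def]
    refine ENNReal.toReal_pos ?_ (isCompact_closedBall _ _).measure_lt_top.ne
    exact (measure_closedBall_pos volume _ one_pos).ne'
  set A : ENNReal := ENNReal.ofReal δ⁻¹ ^ (1 / (2 : ENNReal)).toReal *
    volume K ^ (1 / (1 : ENNReal).toReal - 1 / (2 : ENNReal).toReal) with hA
  have hAtop : A ≠ ⊤ := by
    refine ENNReal.mul_ne_top (ENNReal.rpow_ne_top_of_nonneg (by positivity) (by simp)) ?_
    exact ENNReal.rpow_ne_top_of_nonneg (by norm_num) hKc.measure_lt_top.ne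
  refine ⟨A.toReal / volume.real B, fun F hF hFL z hz => ?_⟩
  have hz' : ‖z‖ ≤ R := by simpa using hz
  have h1 : ‖(volume.real B : ℂ) * F z‖ₑ ≤ A * eLpNorm F 2 w.measure := by
    rw [← integral_closedBall_entire F hF z]
    calc ‖∫ v in B, F (z + v)‖ₑ ≤ ∫⁻ v in B, ‖F (z + v)‖ₑ := enorm_integral_le_lintegral_enorm _
      _ ≤ ∫⁻ v in K, ‖F v‖ₑ := by
          have hmp := measurePreserving_add_left (volume : Measure (Fin n → ℂ)) z
          rw [← hmp.setLIntegral_comp_preimage hKc.measurableSet hF.continuous.measurable.enorm]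
          refine lintegral_mono_set fun v hv => ?_
          have hv' : ‖v‖ ≤ 1 := by simpa [hB] using hv
          have := norm_add_le z v
          simp only [hK, Set.mem_preimage, mem_closedBall, dist_zero_right]
          linarith
      _ = eLpNorm F 1 (volume.restrict K) := by rw [eLpNorm_one_eq_lintegral_enorm]
      _ ≤ eLpNorm F 2 (volume.restrict K) *
            (volume.restrict K) Set.univ ^ (1 / (1 : ENNReal).toReal - 1 / (2 : ENNReal).toReal) :=
          eLpNorm_le_eLpNorm_mul_rpow_measure_univ (by norm_num)
            hF.continuous.aestronglyMeasurable
      _ ≤ (ENNReal.ofReal δ⁻¹ ^ (1 / (2 : ENNReal)).toReal * eLpNorm F 2 w.measure) *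
            volume K ^ (1 / (1 : ENNReal).toReal - 1 / (2 : ENNReal).toReal) := by
          rw [Measure.restrict_apply_univ]
          gcongr
          refine (eLpNorm_mono_measure F hle).trans ?_
          rw [eLpNorm_smul_measure_of_ne_top (by simp), smul_eq_mul]
      _ = _ := by rw [hA]; ring
  have h2 := ENNReal.toReal_mono (ENNReal.mul_ne_top hAtop hFL.eLpNorm_ne_top) h1
  rw [ENNReal.toReal_mul, toReal_enorm, norm_mul, Complex.norm_real, Real.norm_of_nonneg hB0.le] at h2
  rw [div_mul_eq_mul_div, le_div_iff₀ hB0]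
  linarith

/-- The weighted Bergman space: the (classes of) entire functions in `L²(ℂⁿ, w(z) dz)`. -/
noncomputable def space (w : BergmanWeight n) : Submodule ℂ (Lp ℂ 2 w.measure) where
  carrier := {f | ∃ F : (Fin n → ℂ) → ℂ, Differentiable ℂ F ∧ f =ᵐ[w.measure] F}
  zero_mem' := ⟨fun _ => 0, differentiable_const _, Lp.coeFn_zero _ _ _⟩
  add_mem' := by
    rintro f g ⟨F, hF, hfF⟩ ⟨G, hG, hgG⟩
    exact ⟨F + G, hF.add hG, (Lp.coeFn_add f g).trans (hfF.add hgG)⟩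
  smul_mem' := by
    rintro c f ⟨F, hF, hfF⟩
    exact ⟨c • F, hF.const_smul c, (Lp.coeFn_smul c f).trans (hfF.const_smul c)⟩

theorem isClosed_space (w : BergmanWeight n) : IsClosed (w.space : Set (Lp ℂ 2 w.measure)) := by
  apply IsSeqClosed.isClosed
  intro f f₀ hf hlim
  choose F hF hfF using hf
  have hcauchy := hlim.cauchySeq
  have hunif : ∀ R : ℝ, UniformCauchySeqOn F atTop (closedBall (0 : Fin n → ℂ) R) := by
    intro R
    obtain ⟨C, hC⟩ := w.norm_entire_le R
    rw [Metric.uniformCauchySeqOn_iff]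
    intro ε hε
    obtain ⟨N, hN⟩ := Metric.cauchySeq_iff.1 hcauchy (ε / (|C| + 1)) (by positivity)
    refine ⟨N, fun k hk l hl z hz => ?_⟩
    have hae : ⇑(f k - f l) =ᵐ[w.measure] fun z => F k z - F l z :=
      (Lp.coeFn_sub _ _).trans ((hfF k).sub (hfF l))
    have h := hC (fun z => F k z - F l z) ((hF k).sub (hF l))
      ((memLp_congr_ae hae).1 (Lp.memLp _)) z hz
    rw [← eLpNorm_congr_ae hae, ← Lp.norm_def] at h
    have h2 := hN k hk l hl
    rw [dist_eq_norm, lt_div_iff₀ (by positivity)] at h2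
    rw [dist_eq_norm]
    have h3 : C * ‖f k - f l‖ ≤ |C| * ‖f k - f l‖ := by gcongr; exact le_abs_self C
    have := norm_nonneg (f k - f l)
    nlinarith
  obtain ⟨F₀, hF₀, hF₀lim⟩ := exists_entire_limit F hF hunif
  refine ⟨F₀, hF₀, ?_⟩
  obtain ⟨φ, hφ, hae⟩ := (tendstoInMeasure_of_tendsto_Lp hlim).exists_seq_tendsto_ae
  filter_upwards [hae, ae_all_iff.2 hfF] with z hz hfz
  refine tendsto_nhds_unique hz ?_
  simp only [hfz]
  exact (hF₀lim z).comp hφ.tendsto_atTop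

/-- The weighted Bergman space is a Hilbert space; in particular the orthogonal projection
of `L²(ℂⁿ, w(z) dz)` onto it exists. -/
instance (w : BergmanWeight n) : CompleteSpace w.space := w.isClosed_space.completeSpace_coe

/-- The Toeplitz operator `F ↦ P (g F)` with symbol `g` on a linear subspace `D` of the weighted
Bergman space such that `g F` is square integrable for every `F` in `D`; here `P` is the orthogonal
projection of `L²(ℂⁿ, w(z) dz)` onto the weighted Bergman space. -/
noncomputable def toeplitz (w : BergmanWeight n) (g : (Fin n → ℂ) → ℂ) (D : Submodule ℂ w.space)
    (hg : ∀ F ∈ D, MemLp (fun z => g z * (F : Lp ℂ 2 w.measure) z) 2 w.measure) :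
    D →ₗ[ℂ] w.space where
  toFun F := w.space.orthogonalProjectionOnto ((hg F F.2).toLp _)
  map_add' F G := by
    rw [← map_add, ← MemLp.toLp_add]
    congr 1
    rw [MemLp.toLp_eq_toLp_iff]
    filter_upwards [Lp.coeFn_add ((F : w.space) : Lp ℂ 2 w.measure) (G : w.space)] with z hz
    simp only [Submodule.coe_add, hz, Pi.add_apply, mul_add]
  map_smul' c F := by
    rw [RingHom.id_apply, ← map_smul, ← MemLp.toLp_const_smul]
    congr 1
    rw [MemLp.toLp_eq_toLp_iff]
    filter_upwards [Lp.coeFn_smul c ((F : w.space) : Lp ℂ 2 w.measure)] with z hz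
    simp only [Submodule.coe_smul, hz, Pi.smul_apply, smul_eq_mul, mul_left_comm]

end BergmanWeight

/-- A densely defined linear operator `T : D → E` is bounded. -/
def IsBoundedOn {E : Type*} [NormedAddCommGroup E] [NormedSpace ℂ E] {D : Submodule ℂ E}
    (T : D →ₗ[ℂ] E) : Prop :=
  ∃ C : ℝ, ∀ F : D, ‖T F‖ ≤ C * ‖F‖

/-! ### The Segal–Bargmann space and the Fock space -/

/-- The imaginary part `y ∈ ℝⁿ` of `z = x + iy ∈ ℂⁿ`. -/
def imPart {n : ℕ} (z : Fin n → ℂ) : EuclideanSpace ℝ (Fin n) :=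
  WithLp.toLp 2 fun i => (z i).im

theorem continuous_imPart {n : ℕ} : Continuous (imPart : (Fin n → ℂ) → _) := by
  unfold imPart
  fun_prop

/-- The heat kernel `q_s(y) = (4πs)^{-n/2} exp(-|y|²/(4s))` on `ℝⁿ`. -/
noncomputable def heatKernel {n : ℕ} (s : ℝ) (y : EuclideanSpace ℝ (Fin n)) : ℝ :=
  (4 * Real.pi * s) ^ (-(n : ℝ) / 2) * Real.exp (-‖y‖ ^ 2 / (4 * s))

/-- The entire extension `(4πs)^{-n/2} exp(-(z₁² + ⋯ + zₙ²)/(4s))` of the heat kernel to `ℂⁿ`. -/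
noncomputable def complexHeatKernel {n : ℕ} (s : ℝ) (z : Fin n → ℂ) : ℂ :=
  ((4 * Real.pi * s) ^ (-(n : ℝ) / 2) : ℝ) * Complex.exp (-(∑ i, z i ^ 2) / (4 * (s : ℂ)))

/-- The heat kernel `(4πs)^{-n} exp(-|z|²/(4s))` on `ℂⁿ = ℝ²ⁿ`. -/
noncomputable def heatKernelCn {n : ℕ} (s : ℝ) (z : Fin n → ℂ) : ℝ :=
  ((4 * Real.pi * s) ^ n)⁻¹ * Real.exp (-(∑ i, ‖z i‖ ^ 2) / (4 * s))

/-- The convolution `(g * q_s)(ξ)` on `ℝⁿ`. -/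
noncomputable def heatFlow {n : ℕ} (s : ℝ) (g : EuclideanSpace ℝ (Fin n) → ℂ)
    (ξ : EuclideanSpace ℝ (Fin n)) : ℂ :=
  ∫ y, g y * (heatKernel s (ξ - y) : ℂ)

/-- The convolution `(g * q_s)(z)` on `ℂⁿ`. -/
noncomputable def heatFlowCn {n : ℕ} (s : ℝ) (g : (Fin n → ℂ) → ℂ) (z : Fin n → ℂ) : ℂ :=
  ∫ v, g v * (heatKernelCn s (z - v) : ℂ)

/-- The weight `q_{t/2}(y)` of the Segal–Bargmann space `B_t(ℂⁿ)`. -/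
noncomputable def segalBargmannWeight (n : ℕ) (t : ℝ) (ht : 0 < t) : BergmanWeight n where
  toFun z := heatKernel (t / 2) (imPart z)
  continuous_toFun := by
    have := continuous_imPart (n := n)
    unfold heatKernel
    fun_prop
  pos_toFun z := by
    unfold heatKernel
    positivity

/-- The Segal–Bargmann space `B_t(ℂⁿ)`: entire functions square integrable with respect to
`q_{t/2}(y) dx dy`. -/
noncomputable abbrev SegalBargmannSpace (n : ℕ) (t : ℝ) (ht : 0 < t) :=
  (segalBargmannWeight n t ht).space

/-- The weight `(2π)^{-n} exp(-|z|²/2)` of the Fock space `F(ℂⁿ)`. -/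
noncomputable def fockWeight (n : ℕ) : BergmanWeight n where
  toFun z := ((2 * Real.pi) ^ n)⁻¹ * Real.exp (-(∑ i, ‖z i‖ ^ 2) / 2)
  continuous_toFun := by fun_prop
  pos_toFun z := by positivity

/-- The Fock space `F(ℂⁿ)`: entire functions square integrable with respect to
`(2π)^{-n} exp(-|z|²/2) dz`. -/
noncomputable abbrev FockSpace (n : ℕ) := (fockWeight n).space

/-- The Segal–Bargmann transform `(f * q_t)(z) = ∫ f(u) q_t(z - u) du`, `z ∈ ℂⁿ`, where `q_t` is
extended to an entire function. -/
noncomputable def segalBargmannTransform {n : ℕ} (t : ℝ) (f : EuclideanSpace ℝ (Fin n) → ℂ)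
    (z : Fin n → ℂ) : ℂ :=
  ∫ u, f u * complexHeatKernel t fun i => z i - (u i : ℂ)

/-- The function `m_t(ξ) = (g₀ * q_{t/2})(-2tξ)`. -/
noncomputable def toeplitzMultiplier {n : ℕ} (t : ℝ) (g₀ : EuclideanSpace ℝ (Fin n) → ℂ)
    (ξ : EuclideanSpace ℝ (Fin n)) : ℂ :=
  heatFlow (t / 2) g₀ (-(2 * t) • ξ)

/-- A bounded operator `A` on `L²(ℝⁿ)` is the Fourier multiplier with symbol `m`:
`(A f)^(ξ) = m(ξ) f^(ξ)` for almost every `ξ`, where the hat is the unitary Fourier transform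
`(2π)^{-n/2} ∫ f(x) exp(-i x·ξ) dx`. Since Mathlib's `𝓕` is `∫ f(x) exp(-2πi x·η) dx`, frequencies
are related by `ξ = 2πη`. -/
def IsFourierMultiplier {n : ℕ}
    (A : Lp ℂ 2 (volume : Measure (EuclideanSpace ℝ (Fin n))) →L[ℂ]
      Lp ℂ 2 (volume : Measure (EuclideanSpace ℝ (Fin n))))
    (m : EuclideanSpace ℝ (Fin n) → ℂ) : Prop :=
  ∀ f : Lp ℂ 2 (volume : Measure (EuclideanSpace ℝ (Fin n))),
    (𝓕 (A f) : Lp ℂ 2 (volume : Measure (EuclideanSpace ℝ (Fin n)))) =ᵐ[volume]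
      fun η => m ((2 * Real.pi) • η)
        * (𝓕 f : Lp ℂ 2 (volume : Measure (EuclideanSpace ℝ (Fin n)))) η

/-! ### The Fourier transform on `L¹ ∩ L²` -/

/-! On the Fourier side everything becomes multiplication. Since `laplaceKernel t z` integrates to
`q_t(z)`, Parseval gives `U f = laplaceTransform t (𝓕 f)`. On the plane `Im z = y` the transform of
`φ` is an inverse Fourier transform of `φ` times a real Gaussian factor, so Plancherel applies plane
by plane. Completing the square (`heatKernel_mul_normSq_laplaceKernel`) turns the weight
`q_{t/2}(y)` times the squared factor into `q_{t/2}(-4πtη - y)`. Integrating in `y` gives 1 without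
a symbol, hence an isometry, and gives `(g₀ * q_{t/2})(-4πtη)` against `g₀(y)`. So `T_g` is
conjugate to multiplication by this function (`toeplitz_ae_eq`), and `ξ = 2πη` produces the argument
`-2tξ`.

The isometry is onto because Gaussians of time `2t` lie in its range and, up to constants, reproduce
point values: pairing with one is a Gaussian mean of an entire function
(`eq_zero_of_inner_isometry`).

Absolute convergence of the heat flow is extracted from the density of `D` alone. Finiteness of `∫
|g₀|² q_{t/2}(ξ - ·)` first holds for almost every `ξ`, since otherwise all of `D` would vanish on a
common set of positive measure; it then holds everywhere, because a translate of the Gaussian is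
dominated by the translates at the vertices of any polytope containing the point. The same
domination makes the flow continuous, so the essential bound forced by a bounded multiplication
operator is a bound everywhere.

The Fock weight equals `|h|² q_{1/4}(Im z)` with `h` a constant times `exp(-(z₁² + ⋯ + zₙ²)/4)`.
Division by the zero-free entire `h` does not disturb the argument, so it is carried out for all
weights satisfying `IsTwist`, and the Fock case is `t = 1/2`. -/

theorem locallyIntegrable_of_memLp_two {V : Type*} [NormedAddCommGroup V] [InnerProductSpace ℝ V]
    [FiniteDimensional ℝ V] [MeasurableSpace V] [BorelSpace V] {f : V → ℂ} (hf : MemLp f 2) :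
    LocallyIntegrable f := by
  exact hf.locallyIntegrable (by norm_num)

/-- The inverse Fourier transform on `L²` is given by the usual integral on `L¹ ∩ L²`. -/
theorem fourierInv_toLp_ae_eq {V : Type*} [NormedAddCommGroup V] [InnerProductSpace ℝ V]
    [FiniteDimensional ℝ V] [MeasurableSpace V] [BorelSpace V] {f : V → ℂ}
    (hf1 : Integrable f) (hf2 : MemLp f 2) :
    (𝓕⁻ (hf2.toLp f) : Lp ℂ 2 (volume : Measure V)) =ᵐ[volume] 𝓕⁻ f := by
  have hcont : Continuous (𝓕⁻ f) := by
    have h : Continuous (𝓕 f) := VectorFourier.fourierIntegral_continuous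
      Real.continuous_fourierChar continuous_inner hf1
    have : 𝓕⁻ f = fun w => 𝓕 f (-w) := funext fun w => Real.fourierInv_eq_fourier_neg f w
    rw [this]
    exact h.comp continuous_neg
  -- Both sides are tested against smooth compactly supported functions; on the left the `L²`
  -- transform agrees with that of tempered distributions, so it can be moved onto the test
  -- function.
  refine ae_eq_of_integral_contDiff_smul_eq (locallyIntegrable_of_memLp_two (Lp.memLp _))
    hcont.locallyIntegrable fun g hg hgc => ?_
  have hgc' : HasCompactSupport fun x => (g x : ℂ) := hgc.comp_left (g := ((↑) : ℝ → ℂ)) (by simp)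
  have hgs : ContDiff ℝ (⊤ : ℕ∞) fun x => (g x : ℂ) :=
    Complex.ofRealCLM.contDiff.comp hg
  set θ : SchwartzMap V ℂ := hgc'.toSchwartzMap hgs with hθ
  have hθg : ∀ x, θ x = (g x : ℂ) := fun x => rfl
  have h := congrArg (fun T : TemperedDistribution V ℂ => T θ)
    (Lp.fourierInv_toTemperedDistribution_eq (hf2.toLp f))
  simp only [TemperedDistribution.fourierInv_apply, Lp.toTemperedDistribution_apply, hθg] at h
  have h1 : ∀ x, g x • (𝓕⁻ (hf2.toLp f) : Lp ℂ 2 (volume : Measure V)) x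
      = (g x : ℂ) • (𝓕⁻ (hf2.toLp f) : Lp ℂ 2 (volume : Measure V)) x := fun x => by simp
  simp only [h1, ← h]
  have h2 : ∫ x, (𝓕⁻ θ) x • (hf2.toLp f) x = ∫ x, (𝓕⁻ θ) x • f x := by
    refine integral_congr_ae ?_
    filter_upwards [hf2.coeFn_toLp] with x hx
    rw [hx]
  rw [h2]
  -- The pairing `-innerₗ V` makes this symmetry formula one for the inverse transform.
  have h3 := VectorFourier.integral_fourierIntegral_smul_eq_flip (e := Real.fourierChar)
    (μ := (volume : Measure V)) (ν := (volume : Measure V)) (L := -innerₗ V)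
    (f := (θ : V → ℂ)) (g := f) Real.continuous_fourierChar (by
      simp only [LinearMap.neg_apply, innerₗ_apply_apply]; fun_prop) θ.integrable hf1
  have h4 : ∀ x, (𝓕⁻ θ) x = VectorFourier.fourierIntegral Real.fourierChar volume (-innerₗ V)
      (θ : V → ℂ) x := fun x => by rw [SchwartzMap.fourierInv_coe]; rfl
  simp only [h4, h3]
  refine integral_congr_ae (Eventually.of_forall fun x => ?_)
  simp only [hθg, smul_eq_mul, Complex.real_smul]
  congr 1
  simp [VectorFourier.fourierIntegral, Real.fourierInv_eq, real_inner_comm]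

/-! ### The Gaussian Laplace kernel -/

variable {n : ℕ}

/-- The kernel `exp(2πi z·η - 4π²t|η|²)` on `ℂⁿ × ℝⁿ`. -/
noncomputable def laplaceKernel (t : ℝ) (z : Fin n → ℂ) (η : EuclideanSpace ℝ (Fin n)) : ℂ :=
  Complex.exp (-(4 * Real.pi ^ 2 * t : ℂ) * ∑ i, (η i : ℂ) ^ 2
    + ∑ i, (2 * Real.pi * Complex.I * z i) * η i)

/-- The transform `φ ↦ ∫ φ(η) exp(2πi z·η - 4π²t|η|²) dη`. -/
noncomputable def laplaceTransform (t : ℝ) (φ : EuclideanSpace ℝ (Fin n) → ℂ) (z : Fin n → ℂ) : ℂ :=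
  ∫ η, φ η * laplaceKernel t z η

theorem continuous_laplaceKernel (t : ℝ) (z : Fin n → ℂ) : Continuous (laplaceKernel t z) := by
  unfold laplaceKernel
  fun_prop

theorem integrable_laplaceKernel {t : ℝ} (ht : 0 < t) (z : Fin n → ℂ) :
    Integrable (laplaceKernel t z) := by
  rw [← (PiLp.volume_preserving_toLp (Fin n)).integrable_comp_emb
    (MeasurableEquiv.toLp 2 _).measurableEmbedding]
  refine GaussianFourier.integrable_cexp_neg_mul_sum_add (b := (4 * Real.pi ^ 2 * t : ℂ)) ?_
    (fun i => 2 * Real.pi * Complex.I * z i)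
  have : (4 * Real.pi ^ 2 * t : ℂ) = ((4 * Real.pi ^ 2 * t : ℝ) : ℂ) := by push_cast; ring
  rw [this, Complex.ofReal_re]
  positivity

theorem integral_laplaceKernel {t : ℝ} (ht : 0 < t) (z : Fin n → ℂ) :
    ∫ η, laplaceKernel t z η = complexHeatKernel t z := by
  rw [← (PiLp.volume_preserving_toLp (Fin n)).integral_comp
    (MeasurableEquiv.toLp 2 _).measurableEmbedding]
  have hb : (4 * Real.pi ^ 2 * t : ℂ) = ((4 * Real.pi ^ 2 * t : ℝ) : ℂ) := by push_cast; ring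
  refine (GaussianFourier.integral_cexp_neg_mul_sum_add (b := (4 * Real.pi ^ 2 * t : ℂ)) (by
    rw [hb, Complex.ofReal_re]; positivity) (fun i => 2 * Real.pi * Complex.I * z i)).trans ?_
  have hpi := Complex.ofReal_ne_zero.2 Real.pi_ne_zero
  have ht' := Complex.ofReal_ne_zero.2 ht.ne'
  rw [complexHeatKernel]
  congr 1
  · have h1 : (Real.pi / (4 * Real.pi ^ 2 * t) : ℂ) = ((4 * Real.pi * t)⁻¹ : ℝ) := by
      push_cast; field_simp
    have h2 : ((Fintype.card (Fin n) : ℂ) / 2) = ((n / 2 : ℝ) : ℂ) := by simp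
    rw [h1, h2, ← Complex.ofReal_cpow (by positivity), Real.inv_rpow (by positivity),
      ← Real.rpow_neg (by positivity), neg_div]
  · congr 1
    simp only [mul_pow, ← Finset.mul_sum, Complex.I_sq]
    field_simp
    ring

/-- Only the imaginary part of `z` contributes, because `Re (2πi z·η) = -2π y·η`. -/
theorem norm_laplaceKernel (t : ℝ) (z : Fin n → ℂ) (η : EuclideanSpace ℝ (Fin n)) :
    ‖laplaceKernel t z η‖
      = Real.exp (-(4 * Real.pi ^ 2 * t) * ‖η‖ ^ 2 - 2 * Real.pi * inner ℝ (imPart z) η) := by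
  rw [laplaceKernel, Complex.norm_exp, EuclideanSpace.norm_sq_eq]
  congr 1
  simp only [imPart, PiLp.inner_apply, RCLike.inner_apply, conj_trivial, Real.norm_eq_abs, sq_abs,
    Finset.mul_sum, ← Finset.sum_sub_distrib, Complex.add_re, Complex.re_sum,
    ← Finset.sum_add_distrib]
  refine Finset.sum_congr rfl fun i _ => ?_
  simp [pow_two]
  ring

/-- Squaring doubles the exponent and so stays within the family; square integrability of the kernel
thus reduces to integrability. -/
theorem normSq_laplaceKernel (t : ℝ) (z : Fin n → ℂ) (η : EuclideanSpace ℝ (Fin n)) :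
    ‖laplaceKernel t z η‖ ^ 2 = ‖laplaceKernel (2 * t) (fun i => 2 * z i) η‖ := by
  rw [norm_laplaceKernel, norm_laplaceKernel, ← Real.exp_nat_mul]
  congr 1
  have : imPart (fun i => 2 * z i) = (2 : ℝ) • imPart z := by
    ext i; simp [imPart]
  rw [this, inner_smul_left]
  push_cast
  simp only [conj_trivial]
  ring

theorem memLp_laplaceKernel {t : ℝ} (ht : 0 < t) (z : Fin n → ℂ) :
    MemLp (laplaceKernel t z) 2 := by
  rw [memLp_two_iff_integrable_sq_norm (continuous_laplaceKernel t z).aestronglyMeasurable]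
  simp only [normSq_laplaceKernel]
  exact (integrable_laplaceKernel (by positivity) _).norm

/-- The constant is the maximum over `r = ‖η‖` of `exp(-4π²t r² + 2π r ‖y‖)`, attained at `4πt r =
‖y‖`. Hence multiplication by the kernel preserves `L²`. -/
theorem norm_laplaceKernel_le {t : ℝ} (ht : 0 < t) (z : Fin n → ℂ)
    (η : EuclideanSpace ℝ (Fin n)) :
    ‖laplaceKernel t z η‖ ≤ Real.exp (‖imPart z‖ ^ 2 / (4 * t)) := by
  rw [norm_laplaceKernel]
  gcongr
  have h := abs_le.1 (abs_real_inner_le_norm (imPart z) η)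
  rw [le_div_iff₀ (by positivity)]
  have hpi := Real.pi_pos
  nlinarith [sq_nonneg (4 * Real.pi * t * ‖η‖ - ‖imPart z‖), mul_pos hpi ht]

theorem integrable_mul_laplaceKernel {t : ℝ} (ht : 0 < t)
    {φ : EuclideanSpace ℝ (Fin n) → ℂ} (hφ : MemLp φ 2) (z : Fin n → ℂ) :
    Integrable fun η => φ η * laplaceKernel t z η :=
  hφ.integrable_mul (memLp_laplaceKernel ht z)

theorem memLp_mul_laplaceKernel {t : ℝ} (ht : 0 < t)
    {φ : EuclideanSpace ℝ (Fin n) → ℂ} (hφ : MemLp φ 2) (z : Fin n → ℂ) :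
    MemLp (fun η => φ η * laplaceKernel t z η) 2 := by
  refine MemLp.of_le_mul (g := φ) (c := Real.exp (‖imPart z‖ ^ 2 / (4 * t))) hφ
    (hφ.1.mul (continuous_laplaceKernel t z).aestronglyMeasurable)
    (Eventually.of_forall fun η => ?_)
  rw [norm_mul, mul_comm]
  gcongr
  exact norm_laplaceKernel_le ht z η

/-- The point `x + iy` of `ℂⁿ`. -/
def complexPoint (x y : EuclideanSpace ℝ (Fin n)) : Fin n → ℂ := fun i => x i + y i * Complex.I

@[simp] theorem imPart_complexPoint (x y : EuclideanSpace ℝ (Fin n)) :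
    imPart (complexPoint x y) = y := by
  ext i; simp [imPart, complexPoint]

/-- The factor `exp(2πi x·η)` splits off the kernel and leaves the kernel at `iy`, which makes
Plancherel in `x` available. -/
theorem laplaceTransform_complexPoint (t : ℝ) (φ : EuclideanSpace ℝ (Fin n) → ℂ)
    (x y : EuclideanSpace ℝ (Fin n)) :
    laplaceTransform t φ (complexPoint x y)
      = 𝓕⁻ (fun η => φ η * laplaceKernel t (complexPoint 0 y) η) x := by
  rw [laplaceTransform, Real.fourierInv_eq']
  refine integral_congr_ae (Eventually.of_forall fun η => ?_)
  simp only [smul_eq_mul]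
  rw [mul_left_comm, laplaceKernel, laplaceKernel, ← Complex.exp_add]
  congr 2
  simp only [complexPoint, PiLp.inner_apply, RCLike.inner_apply, conj_trivial]
  push_cast
  simp only [Finset.mul_sum, Finset.sum_mul]
  simp only [← Finset.sum_add_distrib]
  refine Finset.sum_congr rfl fun i _ => ?_
  simp
  ring

/-- Parseval's formula for the transform `laplaceTransform`. -/
theorem segalBargmannTransform_eq_laplaceTransform {t : ℝ} (ht : 0 < t)
    (f : Lp ℂ 2 (volume : Measure (EuclideanSpace ℝ (Fin n)))) (z : Fin n → ℂ) :
    segalBargmannTransform t f z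
      = laplaceTransform t (𝓕 f : Lp ℂ 2 (volume : Measure (EuclideanSpace ℝ (Fin n)))) z := by
  -- The kernel is conjugated because it enters the first, conjugate-linear slot of the `L²` inner
  -- product.
  have hint : Integrable fun η => (starRingEnd ℂ) (laplaceKernel t z η) :=
    memLp_one_iff_integrable.1 (memLp_one_iff_integrable.2 (integrable_laplaceKernel ht z)).star
  have hmem : MemLp (fun η => (starRingEnd ℂ) (laplaceKernel t z η)) 2 :=
    (memLp_laplaceKernel ht z).star
  set k := hmem.toLp _ with hk
  have hinv : ∀ u, 𝓕⁻ (fun η => (starRingEnd ℂ) (laplaceKernel t z η)) u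
      = (starRingEnd ℂ) (complexHeatKernel t fun i => z i - (u i : ℂ)) := by
    intro u
    rw [← integral_laplaceKernel ht, ← integral_conj, Real.fourierInv_eq']
    refine integral_congr_ae (Eventually.of_forall fun η => ?_)
    simp only [smul_eq_mul]
    have : Complex.exp (↑(2 * Real.pi * inner ℝ η u) * Complex.I)
        = (starRingEnd ℂ) (Complex.exp (↑(-(2 * Real.pi * inner ℝ η u)) * Complex.I)) := by
      rw [← Complex.exp_conj]
      simp [Complex.conj_ofNat]
    rw [this, ← map_mul]
    congr 1
    rw [laplaceKernel, laplaceKernel, ← Complex.exp_add]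
    congr 1
    simp only [PiLp.inner_apply, RCLike.inner_apply, conj_trivial]
    push_cast
    simp only [Finset.mul_sum, Finset.sum_mul, ← Finset.sum_neg_distrib]
    simp only [← Finset.sum_add_distrib]
    refine Finset.sum_congr rfl fun i _ => ?_
    ring
  have h1 : inner ℂ (𝓕⁻ k) f = inner ℂ k (𝓕 f) := by
    rw [← Lp.inner_fourier_eq (𝓕⁻ k) f, FourierTransform.fourier_fourierInv_eq]
  rw [L2.inner_def, L2.inner_def] at h1
  refine Eq.trans ?_ (h1.trans ?_)
  · refine integral_congr_ae ?_
    filter_upwards [fourierInv_toLp_ae_eq hint hmem] with u hu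
    rw [RCLike.inner_apply, hk, hu, hinv]
    simp
  · refine integral_congr_ae ?_
    filter_upwards [hmem.coeFn_toLp] with u hu
    rw [RCLike.inner_apply, hk, hu]
    simp

/-- Plancherel's formula for `laplaceTransform` on the horizontal plane of height `y`. -/
theorem memLp_laplaceTransform_line {t : ℝ} (ht : 0 < t)
    {φ : EuclideanSpace ℝ (Fin n) → ℂ} (hφ : MemLp φ 2) (y : EuclideanSpace ℝ (Fin n)) :
    MemLp (fun x => laplaceTransform t φ (complexPoint x y)) 2 := by
  simp only [laplaceTransform_complexPoint]
  exact (memLp_congr_ae (fourierInv_toLp_ae_eq (integrable_mul_laplaceKernel ht hφ _)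
    (memLp_mul_laplaceKernel ht hφ _))).1 (Lp.memLp _)

/-- The polarised form of Plancherel is needed, since Toeplitz operators are identified through
their sesquilinear forms. -/
theorem integral_laplaceTransform_line {t : ℝ} (ht : 0 < t)
    {φ ψ : EuclideanSpace ℝ (Fin n) → ℂ} (hφ : MemLp φ 2) (hψ : MemLp ψ 2)
    (y : EuclideanSpace ℝ (Fin n)) :
    ∫ x, laplaceTransform t φ (complexPoint x y)
        * (starRingEnd ℂ) (laplaceTransform t ψ (complexPoint x y))
      = ∫ η, (φ η * laplaceKernel t (complexPoint 0 y) η)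
        * (starRingEnd ℂ) (ψ η * laplaceKernel t (complexPoint 0 y) η) := by
  simp only [laplaceTransform_complexPoint]
  have h1 := integrable_mul_laplaceKernel ht hφ (complexPoint 0 y)
  have h2 := memLp_mul_laplaceKernel ht hφ (complexPoint 0 y)
  have k1 := integrable_mul_laplaceKernel ht hψ (complexPoint 0 y)
  have k2 := memLp_mul_laplaceKernel ht hψ (complexPoint 0 y)
  have h : inner ℂ (𝓕⁻ (k2.toLp _)) (𝓕⁻ (h2.toLp _)) = inner ℂ (k2.toLp _) (h2.toLp _) := by
    rw [← Lp.inner_fourier_eq, FourierTransform.fourier_fourierInv_eq,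
      FourierTransform.fourier_fourierInv_eq]
  rw [L2.inner_def, L2.inner_def] at h
  refine Eq.trans ?_ (h.trans ?_)
  · refine integral_congr_ae ?_
    filter_upwards [fourierInv_toLp_ae_eq h1 h2, fourierInv_toLp_ae_eq k1 k2] with x hx hx'
    rw [RCLike.inner_apply, hx, hx']
  · refine integral_congr_ae ?_
    filter_upwards [h2.coeFn_toLp, k2.coeFn_toLp] with x hx hx'
    rw [RCLike.inner_apply, hx, hx']

/-- Completing the square: `|y|²/(2t) + 4π y·η + 8π²t|η|² = |y + 4πtη|²/(2t)`. This is where the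
convolution with `q_{t/2}` originates. -/
theorem heatKernel_mul_normSq_laplaceKernel {t : ℝ} (ht : 0 < t)
    (y η : EuclideanSpace ℝ (Fin n)) :
    heatKernel (t / 2) y * ‖laplaceKernel t (complexPoint 0 y) η‖ ^ 2
      = heatKernel (t / 2) (-(4 * Real.pi * t) • η - y) := by
  rw [norm_laplaceKernel, ← Real.exp_nat_mul, heatKernel, heatKernel, mul_assoc, ← Real.exp_add]
  congr 2
  rw [norm_sub_sq_real, norm_smul, inner_smul_left, imPart_complexPoint, real_inner_comm]
  simp only [conj_trivial, norm_neg, Real.norm_eq_abs, mul_pow, sq_abs]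
  push_cast
  field_simp
  ring

/-- The isometry property underlying the Segal–Bargmann transform, plane by plane. -/
theorem integral_laplaceTransform_mul_heatKernel {t : ℝ} (ht : 0 < t)
    {φ ψ : EuclideanSpace ℝ (Fin n) → ℂ} (hφ : MemLp φ 2) (hψ : MemLp ψ 2)
    (y : EuclideanSpace ℝ (Fin n)) :
    ∫ x, (laplaceTransform t φ (complexPoint x y)
        * (starRingEnd ℂ) (laplaceTransform t ψ (complexPoint x y))) * (heatKernel (t / 2) y : ℂ)
      = ∫ η, (φ η * (starRingEnd ℂ) (ψ η))
        * (heatKernel (t / 2) (-(4 * Real.pi * t) • η - y) : ℂ) := by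
  rw [integral_mul_const, integral_laplaceTransform_line ht hφ hψ, ← integral_mul_const]
  refine integral_congr_ae (Eventually.of_forall fun η => ?_)
  simp only [← heatKernel_mul_normSq_laplaceKernel ht, Complex.ofReal_mul, Complex.ofReal_pow,
    ← Complex.mul_conj', map_mul]
  ring

/-! ### `laplaceTransform φ` is entire -/

theorem hasFDerivAt_laplaceKernel (t : ℝ) (z : Fin n → ℂ) (η : EuclideanSpace ℝ (Fin n)) :
    HasFDerivAt (fun z => laplaceKernel t z η)
      (laplaceKernel t z η • ∑ i, (2 * Real.pi * Complex.I * η i) •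
        (ContinuousLinearMap.proj i : (Fin n → ℂ) →L[ℂ] ℂ)) z := by
  have h : HasFDerivAt (fun z : Fin n → ℂ => -(4 * Real.pi ^ 2 * t : ℂ) * ∑ i, (η i : ℂ) ^ 2
      + ∑ i, (2 * Real.pi * Complex.I * z i) * η i)
      (∑ i, (2 * Real.pi * Complex.I * η i) •
        (ContinuousLinearMap.proj i : (Fin n → ℂ) →L[ℂ] ℂ)) z := by
    refine HasFDerivAt.const_add _ (HasFDerivAt.fun_sum fun i _ => ?_)
    have := ((ContinuousLinearMap.proj i : (Fin n → ℂ) →L[ℂ] ℂ).hasFDerivAt (x := z)).const_mul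
      (2 * Real.pi * Complex.I * η i)
    refine this.congr_of_eventuallyEq (Eventually.of_forall fun w => ?_)
    simp only [ContinuousLinearMap.proj_apply]
    ring
  exact h.cexp

/-- Differentiating in `z` brings down a factor of size `‖η‖`; half of the Gaussian decay absorbs
it, uniformly for bounded imaginary part. -/
theorem exists_norm_mul_laplaceKernel_le {t : ℝ} (ht : 0 < t) (R : ℝ) :
    ∃ C : ℝ, ∀ z : Fin n → ℂ, ‖imPart z‖ ≤ R → ∀ η : EuclideanSpace ℝ (Fin n),
      ‖η‖ * ‖laplaceKernel t z η‖ ≤ C * ‖laplaceKernel (t / 2) 0 η‖ := by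
  -- After `‖η‖ ≤ exp ‖η‖`, the exponent of the constant is the maximum of `(2πR + 1) r - 2π²t r²`.
  refine ⟨Real.exp ((2 * Real.pi * R + 1) ^ 2 / (8 * Real.pi ^ 2 * t)), fun z hz η => ?_⟩
  have hpi := Real.pi_pos
  have h0 : imPart (0 : Fin n → ℂ) = 0 := by ext i; simp [imPart]
  rw [norm_laplaceKernel, norm_laplaceKernel, h0, inner_zero_left, ← Real.exp_add]
  calc ‖η‖ * Real.exp _ ≤ Real.exp ‖η‖ * Real.exp _ := by
        gcongr
        linarith [Real.add_one_le_exp ‖η‖]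
    _ = Real.exp _ := (Real.exp_add _ _).symm
    _ ≤ _ := by
        refine Real.exp_le_exp.2 ?_
        have h1 := (abs_le.1 (abs_real_inner_le_norm (imPart z) η)).1
        have h2 : ‖imPart z‖ * ‖η‖ ≤ R * ‖η‖ := by gcongr
        have h3 : -(2 * Real.pi * inner ℝ (imPart z) η) ≤ 2 * Real.pi * (R * ‖η‖) := by
          have := mul_le_mul_of_nonneg_left (h1.trans' (neg_le_neg h2)) hpi.le
          nlinarith
        have h4 : (2 * Real.pi * R + 1) * ‖η‖ - 2 * Real.pi ^ 2 * t * ‖η‖ ^ 2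
            ≤ (2 * Real.pi * R + 1) ^ 2 / (8 * Real.pi ^ 2 * t) := by
          rw [le_div_iff₀ (by positivity)]
          nlinarith [sq_nonneg (4 * Real.pi ^ 2 * t * ‖η‖ - (2 * Real.pi * R + 1))]
        nlinarith

/-- Differentiation under the integral: near `z₀` the derivative is dominated by `‖φ‖` times a fixed
Gaussian, a product of two `L²` functions. -/
theorem differentiable_laplaceTransform {t : ℝ} (ht : 0 < t)
    {φ : EuclideanSpace ℝ (Fin n) → ℂ} (hφ : MemLp φ 2) :
    Differentiable ℂ (laplaceTransform t φ) := by
  intro z₀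
  obtain ⟨R, hR⟩ := (isCompact_closedBall z₀ 1).exists_bound_of_continuousOn
    (continuous_imPart (n := n)).continuousOn
  obtain ⟨C, hC⟩ := exists_norm_mul_laplaceKernel_le (n := n) ht R
  set L : EuclideanSpace ℝ (Fin n) → ((Fin n → ℂ) →L[ℂ] ℂ) := fun η =>
    ∑ i, (2 * Real.pi * Complex.I * η i) • (ContinuousLinearMap.proj i : (Fin n → ℂ) →L[ℂ] ℂ)
    with hL
  have hLc : Continuous L := by
    rw [hL]
    fun_prop
  have hLn : ∀ η, ‖L η‖ ≤ n * (2 * Real.pi) * ‖η‖ := by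
    intro η
    calc ‖L η‖ ≤ ∑ i : Fin n, 2 * Real.pi * ‖η‖ := by
          refine norm_sum_le_of_le _ fun i _ => ?_
          rw [norm_smul]
          have h1 : ‖(ContinuousLinearMap.proj i : (Fin n → ℂ) →L[ℂ] ℂ)‖ ≤ 1 :=
            ContinuousLinearMap.opNorm_le_bound _ zero_le_one fun v => by
              simpa using norm_le_pi_norm v i
          have h2 : ‖(2 * Real.pi * Complex.I * η i : ℂ)‖ ≤ 2 * Real.pi * ‖η‖ := by
            simp only [norm_mul, Complex.norm_ofNat, Complex.norm_real, Complex.norm_I, mul_one,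
              Real.norm_of_nonneg Real.pi_pos.le]
            gcongr
            exact PiLp.norm_apply_le η i
          calc _ ≤ 2 * Real.pi * ‖η‖ * 1 := by gcongr
            _ = _ := mul_one _
      _ = _ := by simp; ring
  refine (hasFDerivAt_integral_of_dominated_of_fderiv_le (𝕜 := ℂ) (s := ball z₀ 1)
    (F' := fun z η => φ η • laplaceKernel t z η • L η)
    (bound := fun η => ‖φ η‖ * (n * (2 * Real.pi) * (C * ‖laplaceKernel (t / 2) 0 η‖)))
    (ball_mem_nhds z₀ one_pos) (Eventually.of_forall fun z => ?_)
    (integrable_mul_laplaceKernel ht hφ z₀) ?_ ?_ ?_ ?_).differentiableAt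
  · exact (integrable_mul_laplaceKernel ht hφ z).1
  · exact hφ.1.smul ((continuous_laplaceKernel t z₀).smul hLc).aestronglyMeasurable
  · refine Eventually.of_forall fun η z hz => ?_
    rw [norm_smul, norm_smul]
    gcongr ‖φ η‖ * ?_
    calc ‖laplaceKernel t z η‖ * ‖L η‖
        ≤ ‖laplaceKernel t z η‖ * (n * (2 * Real.pi) * ‖η‖) := by gcongr; exact hLn η
      _ = n * (2 * Real.pi) * (‖η‖ * ‖laplaceKernel t z η‖) := by ring
      _ ≤ _ := by
        have := Real.pi_pos
        exact mul_le_mul_of_nonneg_left (hC z (hR z (ball_subset_closedBall hz)) η) (by positivity)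
  · have hg := ((memLp_laplaceKernel (n := n) (half_pos ht) 0).norm.const_mul
      (n * (2 * Real.pi) * C))
    refine (hφ.norm.integrable_mul hg).congr (Eventually.of_forall fun η => ?_)
    simp only [Pi.mul_apply]
    ring
  · exact Eventually.of_forall fun η z _ => (hasFDerivAt_laplaceKernel t z η).const_mul (φ η)

/-! ### Horizontal planes in `ℂⁿ` -/

/-- The measurable equivalence `(x, y) ↦ x + iy`. -/
noncomputable def complexPointEquiv (n : ℕ) :
    EuclideanSpace ℝ (Fin n) × EuclideanSpace ℝ (Fin n) ≃ᵐ (Fin n → ℂ) where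
  toFun p := complexPoint p.1 p.2
  invFun z := (WithLp.toLp 2 fun i => (z i).re, imPart z)
  left_inv p := by
    ext i <;> simp [complexPoint, imPart]
  right_inv z := by
    ext i
    simp [complexPoint, imPart]
  measurable_toFun := by
    refine Continuous.measurable ?_
    simp only [Equiv.coe_fn_mk]
    unfold complexPoint
    fun_prop
  measurable_invFun := by
    refine Continuous.measurable ?_
    simp only [Equiv.coe_fn_symm_mk]
    have := continuous_imPart (n := n)
    fun_prop

theorem complexPointEquiv_apply (p : EuclideanSpace ℝ (Fin n) × EuclideanSpace ℝ (Fin n)) :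
    complexPointEquiv n p = complexPoint p.1 p.2 := rfl

theorem measurePreserving_complexPointEquiv (n : ℕ) :
    MeasurePreserving (complexPointEquiv n) := by
  have h1 := (PiLp.volume_preserving_ofLp (Fin n)).prod (PiLp.volume_preserving_ofLp (Fin n))
  have h2 := (volume_measurePreserving_arrowProdEquivProdArrow ℝ ℝ (Fin n)).symm
  have h3 := volume_preserving_pi (fun _ : Fin n => Complex.volume_preserving_equiv_real_prod.symm)
  refine ((h3.comp h2).comp h1).congr (complexPointEquiv n).measurable
    (Eventually.of_forall fun p => ?_)
  ext i
  simp [complexPointEquiv_apply, complexPoint, MeasurableEquiv.arrowProdEquivProdArrow,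
    Complex.measurableEquivRealProd, Equiv.arrowProdEquivProdArrow,
    Complex.equivRealProdCLM_symm_apply]

/-! ### The heat kernel -/

theorem continuous_heatKernel (s : ℝ) :
    Continuous (heatKernel s : EuclideanSpace ℝ (Fin n) → ℝ) := by
  unfold heatKernel
  fun_prop

theorem heatKernel_pos {s : ℝ} (hs : 0 < s) (y : EuclideanSpace ℝ (Fin n)) :
    0 < heatKernel s y := by
  unfold heatKernel
  positivity

theorem integrable_heatKernel {s : ℝ} (hs : 0 < s) :
    Integrable (heatKernel s : EuclideanSpace ℝ (Fin n) → ℝ) := by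
  have h := (GaussianFourier.integrable_cexp_neg_mul_sq_norm_add (V := EuclideanSpace ℝ (Fin n))
    (b := ((4 * s)⁻¹ : ℝ)) (by rw [Complex.ofReal_re]; positivity) 0 0).norm
  refine (h.const_mul ((4 * Real.pi * s) ^ (-(n : ℝ) / 2))).congr
    (Eventually.of_forall fun y => ?_)
  simp only [heatKernel, Complex.norm_exp, zero_mul, add_zero]
  congr 2
  rw [← Complex.ofReal_neg, ← Complex.ofReal_pow, ← Complex.ofReal_mul, Complex.ofReal_re]
  ring

theorem integral_heatKernel {s : ℝ} (hs : 0 < s) :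
    ∫ y : EuclideanSpace ℝ (Fin n), heatKernel s y = 1 := by
  have h := GaussianFourier.integral_rexp_neg_mul_sq_norm (V := EuclideanSpace ℝ (Fin n))
    (b := (4 * s)⁻¹) (by positivity)
  have h1 : ∀ y : EuclideanSpace ℝ (Fin n),
      -‖y‖ ^ 2 / (4 * s) = -(4 * s)⁻¹ * ‖y‖ ^ 2 := fun y => by ring
  simp only [heatKernel, h1]
  rw [integral_const_mul, h, finrank_euclideanSpace_fin, div_inv_eq_mul, neg_div,
    Real.rpow_neg (by positivity), ← mul_assoc, mul_comm Real.pi 4]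
  exact inv_mul_cancel₀ (by positivity)

theorem lintegral_heatKernel_sub {s : ℝ} (hs : 0 < s) (ξ : EuclideanSpace ℝ (Fin n)) :
    ∫⁻ y, ENNReal.ofReal (heatKernel s (ξ - y)) = 1 := by
  rw [lintegral_sub_left_eq_self (fun y => ENNReal.ofReal (heatKernel s y)),
    ← ofReal_integral_eq_lintegral_ofReal (integrable_heatKernel hs)
      (Eventually.of_forall fun y => (heatKernel_pos hs y).le), integral_heatKernel hs,
    ENNReal.ofReal_one]

theorem integral_heatKernel_sub {s : ℝ} (hs : 0 < s) (ξ : EuclideanSpace ℝ (Fin n)) :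
    ∫ y, heatKernel s (ξ - y) = 1 := by
  rw [integral_sub_left_eq_self (fun y => heatKernel s y), integral_heatKernel hs]

/-! ### Weights of the form `|h(z)|² q_{t/2}(y)` -/

/-- The weight has the form `|h(z)|² q_{t/2}(y)` with an entire function `h` without zeros. -/
structure BergmanWeight.IsTwist (w : BergmanWeight n) (t : ℝ) (h : (Fin n → ℂ) → ℂ) : Prop where
  differentiable : Differentiable ℂ h
  ne_zero : ∀ z, h z ≠ 0
  toFun_eq : ∀ z, w.toFun z = ‖h z‖ ^ 2 * heatKernel (t / 2) (imPart z)

theorem quasiMeasurePreserving_imPart :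
    Measure.QuasiMeasurePreserving (imPart : (Fin n → ℂ) → EuclideanSpace ℝ (Fin n)) := by
  have h1 := (measurePreserving_complexPointEquiv n).symm.quasiMeasurePreserving
  have h2 : Measure.QuasiMeasurePreserving
      (Prod.snd : EuclideanSpace ℝ (Fin n) × EuclideanSpace ℝ (Fin n) → _) volume volume :=
    Measure.quasiMeasurePreserving_snd
  exact h2.comp h1

theorem enorm_sq_eq_ofReal {x : ℂ} : ‖x‖ₑ ^ 2 = ENNReal.ofReal (‖x‖ ^ 2) := by
  rw [ENNReal.ofReal_pow (norm_nonneg _), ofReal_norm]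

theorem memLp_two_iff_lintegral_lt_top {α : Type*} [MeasurableSpace α] {μ : Measure α} {f : α → ℂ}
    (hf : AEStronglyMeasurable f μ) : MemLp f 2 μ ↔ ∫⁻ a, ‖f a‖ₑ ^ 2 ∂μ < ⊤ := by
  rw [MemLp, and_iff_right hf, eLpNorm_lt_top_iff_lintegral_rpow_enorm_lt_top (by simp) (by simp)]
  simp

/-- The nonnegative version of the plane-by-plane isometry, so that Tonelli can be used before any
integrability over `ℂⁿ` is known. -/
theorem lintegral_laplaceTransform_line {t : ℝ} (ht : 0 < t)
    {φ : EuclideanSpace ℝ (Fin n) → ℂ} (hφ : MemLp φ 2) (y : EuclideanSpace ℝ (Fin n)) :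
    ∫⁻ x, ‖laplaceTransform t φ (complexPoint x y)‖ₑ ^ 2 * ENNReal.ofReal (heatKernel (t / 2) y)
      = ∫⁻ η, ‖φ η‖ₑ ^ 2 *
          ENNReal.ofReal (heatKernel (t / 2) (-(4 * Real.pi * t) • η - y)) := by
  have hq := fun y : EuclideanSpace ℝ (Fin n) => (heatKernel_pos (half_pos ht) y).le
  have h := integral_laplaceTransform_mul_heatKernel ht hφ hφ y
  simp only [Complex.mul_conj', ← Complex.ofReal_pow, ← Complex.ofReal_mul] at h
  rw [integral_complex_ofReal, integral_complex_ofReal, Complex.ofReal_inj] at h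
  have i1 : Integrable fun x => ‖laplaceTransform t φ (complexPoint x y)‖ ^ 2
      * heatKernel (t / 2) y :=
    (memLp_laplaceTransform_line ht hφ y).integrable_norm_pow (by norm_num) |>.mul_const _
  have i2 : Integrable fun η => ‖φ η‖ ^ 2 *
      heatKernel (t / 2) (-(4 * Real.pi * t) • η - y) := by
    refine (((memLp_mul_laplaceKernel ht hφ (complexPoint 0 y)).integrable_norm_pow
      (by norm_num)).const_mul (heatKernel (t / 2) y)).congr (Eventually.of_forall fun η => ?_)
    simp only [← heatKernel_mul_normSq_laplaceKernel ht, norm_mul]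
    ring
  simp only [enorm_sq_eq_ofReal, ← ENNReal.ofReal_mul (sq_nonneg _)]
  rw [← ofReal_integral_eq_lintegral_ofReal i1
      (Eventually.of_forall fun x => mul_nonneg (sq_nonneg _) (hq _)),
    ← ofReal_integral_eq_lintegral_ofReal i2
      (Eventually.of_forall fun x => mul_nonneg (sq_nonneg _) (hq _)), h]

namespace BergmanWeight.IsTwist

variable {w : BergmanWeight n} {t : ℝ} {h : (Fin n → ℂ) → ℂ}

theorem differentiable_div (hw : w.IsTwist t h) (ht : 0 < t)
    {φ : EuclideanSpace ℝ (Fin n) → ℂ} (hφ : MemLp φ 2) :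
    Differentiable ℂ fun z => laplaceTransform t φ z / h z := by
  simp only [div_eq_mul_inv]
  exact fun z => (differentiable_laplaceTransform ht hφ z).mul
    ((hw.differentiable z).inv (hw.ne_zero z))

/-- The `|h|²` in the weight cancels the division by `h`, and `k` is constant on each horizontal
plane. Allowing `k` to take values in `ENNReal` covers `|g₀|²` without assumptions on its size. -/
theorem lintegral_measure (hw : w.IsTwist t h) (ht : 0 < t)
    {φ : EuclideanSpace ℝ (Fin n) → ℂ} (hφ : MemLp φ 2)
    {k : EuclideanSpace ℝ (Fin n) → ENNReal} (hk : AEMeasurable k) :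
    ∫⁻ z, k (imPart z) * ‖laplaceTransform t φ z / h z‖ₑ ^ 2 ∂w.measure
      = ∫⁻ y, ∫⁻ η, k y * (‖φ η‖ₑ ^ 2 *
          ENNReal.ofReal (heatKernel (t / 2) (-(4 * Real.pi * t) • η - y))) := by
  have hq := fun y : EuclideanSpace ℝ (Fin n) => (heatKernel_pos (half_pos ht) y).le
  have hkm : AEMeasurable fun z : Fin n → ℂ => k (imPart z) :=
    hk.comp_quasiMeasurePreserving quasiMeasurePreserving_imPart
  have hFm := (hw.differentiable_div ht hφ).continuous.measurable.enorm.pow_const 2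
  have hLm := (differentiable_laplaceTransform ht hφ).continuous.measurable.enorm.pow_const 2
  have hqm : Measurable fun z : Fin n → ℂ => ENNReal.ofReal (heatKernel (t / 2) (imPart z)) :=
    ((continuous_heatKernel _).comp continuous_imPart).measurable.ennreal_ofReal
  refine (lintegral_withDensity_eq_lintegral_mul₀
    w.continuous_toFun.measurable.ennreal_ofReal.aemeasurable (hkm.mul hFm.aemeasurable)).trans ?_
  have h1 : ∀ z, ((fun z => ENNReal.ofReal (w.toFun z)) *
      ((fun z => k (imPart z)) * fun z => ‖laplaceTransform t φ z / h z‖ₑ ^ 2)) z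
      = k (imPart z) * (‖laplaceTransform t φ z‖ₑ ^ 2 *
        ENNReal.ofReal (heatKernel (t / 2) (imPart z))) := by
    intro z
    have h0 := hw.ne_zero z
    simp only [Pi.mul_apply]
    rw [mul_left_comm]
    congr 1
    rw [enorm_sq_eq_ofReal, enorm_sq_eq_ofReal, ← ENNReal.ofReal_mul (sq_nonneg _),
      ← ENNReal.ofReal_mul (w.pos_toFun z).le, hw.toFun_eq, norm_div]
    have := norm_ne_zero_iff.2 h0
    congr 1
    field_simp
  have hm : AEMeasurable fun z : Fin n → ℂ => k (imPart z) * (‖laplaceTransform t φ z‖ₑ ^ 2 *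
        ENNReal.ofReal (heatKernel (t / 2) (imPart z))) :=
    hkm.mul (hLm.mul hqm).aemeasurable
  simp only [h1]
  have hmp := measurePreserving_complexPointEquiv n
  rw [← hmp.lintegral_comp_emb (complexPointEquiv n).measurableEmbedding,
    Measure.volume_eq_prod]
  refine (lintegral_prod_symm _
    (hm.comp_quasiMeasurePreserving hmp.quasiMeasurePreserving)).trans
    (lintegral_congr fun y => ?_)
  simp only [Function.comp_apply, complexPointEquiv_apply, imPart_complexPoint]
  have hline : Continuous fun x => laplaceTransform t φ (complexPoint x y) := by
    refine (differentiable_laplaceTransform ht hφ).continuous.comp ?_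
    unfold complexPoint
    fun_prop
  have hc : Continuous fun η => heatKernel (t / 2) (-(4 * Real.pi * t) • η - y) :=
    (continuous_heatKernel _).comp (by fun_prop)
  rw [lintegral_const_mul _ ((hline.measurable.enorm.pow_const 2).mul_const _),
    lintegral_laplaceTransform_line ht hφ]
  exact (lintegral_const_mul'' _ ((hφ.1.enorm.pow_const 2).mul
    hc.measurable.ennreal_ofReal.aemeasurable)).symm

theorem aemeasurable_joint (t : ℝ) {φ : EuclideanSpace ℝ (Fin n) → ENNReal}
    (hφ : AEMeasurable φ) {k : EuclideanSpace ℝ (Fin n) → ENNReal} (hk : AEMeasurable k) :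
    AEMeasurable (fun p : EuclideanSpace ℝ (Fin n) × EuclideanSpace ℝ (Fin n) =>
      k p.1 * (φ p.2 *
        ENNReal.ofReal (heatKernel (t / 2) (-(4 * Real.pi * t) • p.2 - p.1))))
      (volume.prod volume) := by
  have hc : Continuous fun p : EuclideanSpace ℝ (Fin n) × EuclideanSpace ℝ (Fin n) =>
      heatKernel (t / 2) (-(4 * Real.pi * t) • p.2 - p.1) :=
    (continuous_heatKernel _).comp (by fun_prop)
  exact hk.comp_fst.mul (hφ.comp_snd.mul hc.measurable.ennreal_ofReal.aemeasurable)

/-- With `k = 1` this yields the isometry; with `k = |g₀|²` it says which `φ` correspond to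
functions that the symbol multiplies into `L²`. -/
theorem lintegral_measure_eq (hw : w.IsTwist t h) (ht : 0 < t)
    {φ : EuclideanSpace ℝ (Fin n) → ℂ} (hφ : MemLp φ 2)
    {k : EuclideanSpace ℝ (Fin n) → ENNReal} (hk : AEMeasurable k) :
    ∫⁻ z, k (imPart z) * ‖laplaceTransform t φ z / h z‖ₑ ^ 2 ∂w.measure
      = ∫⁻ η, (∫⁻ y, k y *
          ENNReal.ofReal (heatKernel (t / 2) (-(4 * Real.pi * t) • η - y))) * ‖φ η‖ₑ ^ 2 := by
  rw [hw.lintegral_measure ht hφ hk, lintegral_lintegral_swap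
    (aemeasurable_joint t (hφ.1.enorm.pow_const 2) hk)]
  refine lintegral_congr fun η => ?_
  have hc : Continuous fun y => heatKernel (t / 2) (-(4 * Real.pi * t) • η - y) :=
    (continuous_heatKernel _).comp (by fun_prop)
  refine Eq.trans ?_ (lintegral_mul_const'' _
    (hk.mul hc.measurable.ennreal_ofReal.aemeasurable))
  refine lintegral_congr fun y => ?_
  ring

theorem lintegral_enorm_sq (hw : w.IsTwist t h) (ht : 0 < t)
    {φ : EuclideanSpace ℝ (Fin n) → ℂ} (hφ : MemLp φ 2) :
    ∫⁻ z, ‖laplaceTransform t φ z / h z‖ₑ ^ 2 ∂w.measure = ∫⁻ η, ‖φ η‖ₑ ^ 2 := by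
  have := hw.lintegral_measure_eq ht hφ (k := fun _ => 1) aemeasurable_const
  simpa [lintegral_heatKernel_sub (half_pos ht)] using this

theorem memLp_div (hw : w.IsTwist t h) (ht : 0 < t)
    {φ : EuclideanSpace ℝ (Fin n) → ℂ} (hφ : MemLp φ 2) :
    MemLp (fun z => laplaceTransform t φ z / h z) 2 w.measure := by
  rw [memLp_two_iff_lintegral_lt_top
    (hw.differentiable_div ht hφ).continuous.aestronglyMeasurable, hw.lintegral_enorm_sq ht hφ]
  exact (memLp_two_iff_lintegral_lt_top hφ.1).1 hφ

theorem eLpNorm_div (hw : w.IsTwist t h) (ht : 0 < t)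
    {φ : EuclideanSpace ℝ (Fin n) → ℂ} (hφ : MemLp φ 2) :
    eLpNorm (fun z => laplaceTransform t φ z / h z) 2 w.measure = eLpNorm φ 2 := by
  rw [eLpNorm_eq_lintegral_rpow_enorm_toReal (by simp) (by simp),
    eLpNorm_eq_lintegral_rpow_enorm_toReal (by simp) (by simp)]
  have := hw.lintegral_enorm_sq ht hφ
  simpa using congrArg (fun a => a ^ (1 / 2 : ℝ)) this

/-- The bilinear identity behind the diagonalisation of Toeplitz operators. -/
theorem integral_measure_eq (hw : w.IsTwist t h) (ht : 0 < t)
    {φ ψ : EuclideanSpace ℝ (Fin n) → ℂ} (hφ : MemLp φ 2) (hψ : MemLp ψ 2)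
    {g : EuclideanSpace ℝ (Fin n) → ℂ} (hg : AEMeasurable g)
    (hgφ : MemLp (fun z => g (imPart z) * (laplaceTransform t φ z / h z)) 2 w.measure) :
    Integrable (fun η => heatFlow (t / 2) g (-(4 * Real.pi * t) • η) *
      (φ η * (starRingEnd ℂ) (ψ η))) ∧
    ∫ z, (g (imPart z) * (laplaceTransform t φ z / h z))
        * (starRingEnd ℂ) (laplaceTransform t ψ z / h z) ∂w.measure
      = ∫ η, heatFlow (t / 2) g (-(4 * Real.pi * t) • η) * (φ η * (starRingEnd ℂ) (ψ η)) := by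
  set q : EuclideanSpace ℝ (Fin n) → EuclideanSpace ℝ (Fin n) → ℝ := fun y η =>
    heatKernel (t / 2) (-(4 * Real.pi * t) • η - y) with hq
  have hqc : Continuous fun p : EuclideanSpace ℝ (Fin n) × EuclideanSpace ℝ (Fin n) =>
      q p.1 p.2 := (continuous_heatKernel _).comp (by fun_prop)
  have hq0 : ∀ y η, 0 < q y η := fun y η => heatKernel_pos (half_pos ht) _
  have hk : AEMeasurable fun y => ‖g y‖ₑ ^ 2 := hg.enorm.pow_const 2
  have hjoint : Integrable (fun p : EuclideanSpace ℝ (Fin n) × EuclideanSpace ℝ (Fin n) =>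
      g p.1 * ((φ p.2 * (starRingEnd ℂ) (ψ p.2)) * (q p.1 p.2 : ℂ))) (volume.prod volume) := by
    have hψc : AEStronglyMeasurable (fun η => (starRingEnd ℂ) (ψ η)) volume := hψ.star.1
    refine ⟨hg.aestronglyMeasurable.comp_fst.mul ((hφ.1.comp_snd.mul hψc.comp_snd).mul
      (Complex.continuous_ofReal.comp hqc).aestronglyMeasurable), ?_⟩
    rw [hasFiniteIntegral_iff_enorm]
    have m1 := aemeasurable_joint t (hφ.1.enorm.pow_const 2) hk
    have m2 := aemeasurable_joint t (hψ.1.enorm.pow_const 2)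
      (k := fun _ => 1) aemeasurable_const
    have f1 := hw.lintegral_measure ht hφ hk
    have f2 := hw.lintegral_measure ht hψ (k := fun _ => 1) aemeasurable_const
    rw [← lintegral_prod (μ := volume) (ν := volume) _ m1] at f1
    rw [← lintegral_prod (μ := volume) (ν := volume) _ m2] at f2
    -- Joint integrability from `|gφψ| q ≤ (|gφ|² + |ψ|²) q`: the first term is the norm of the
    -- symbol times the transform of `φ`, the second the norm of the transform of `ψ`. No
    -- integrability of `g` itself is used.
    refine lt_of_le_of_lt (lintegral_mono (g := fun p => _ + _) fun p => ?_)
      ((lintegral_add_left' m1 _).trans_lt (ENNReal.add_lt_top.2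
        ⟨f1.symm.trans_lt ?_, f2.symm.trans_lt ?_⟩))
    · simp only [enorm_mul, RCLike.enorm_conj, one_mul]
      have e : ‖(q p.1 p.2 : ℂ)‖ₑ = ENNReal.ofReal (q p.1 p.2) := by
        rw [← ofReal_norm, Complex.norm_real, Real.norm_of_nonneg (hq0 _ _).le]
      rw [e, ← mul_assoc, ← mul_assoc, ← mul_assoc, ← add_mul, ← mul_pow]
      gcongr
      rcases le_total (‖g p.1‖ₑ * ‖φ p.2‖ₑ) ‖ψ p.2‖ₑ with hle | hle
      · refine le_add_left ?_
        rw [pow_two]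
        gcongr
      · refine le_add_right ?_
        rw [pow_two]
        gcongr
    · simp only [← mul_pow, ← enorm_mul]
      exact (memLp_two_iff_lintegral_lt_top hgφ.1).1 hgφ
    · simp only [one_mul]
      exact (memLp_two_iff_lintegral_lt_top (hw.memLp_div ht hψ).1).1 (hw.memLp_div ht hψ)
  have hflow : ∀ η, ∫ y, g y * ((φ η * (starRingEnd ℂ) (ψ η)) * (q y η : ℂ))
      = heatFlow (t / 2) g (-(4 * Real.pi * t) • η) * (φ η * (starRingEnd ℂ) (ψ η)) := by
    intro η
    rw [heatFlow, ← integral_mul_const]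
    refine integral_congr_ae (Eventually.of_forall fun y => ?_)
    simp only [hq]
    ring
  have hint := hjoint.integral_prod_right
  simp only [hflow] at hint
  refine ⟨hint, ?_⟩
  have hmp := measurePreserving_complexPointEquiv n
  have hI : Integrable (fun z => (g (imPart z) * (laplaceTransform t φ z / h z))
        * (starRingEnd ℂ) (laplaceTransform t ψ z / h z)) w.measure :=
    hgφ.integrable_mul (hw.memLp_div ht hψ).star
  have hwm : Measurable fun z => (w.toFun z).toNNReal :=
    w.continuous_toFun.measurable.real_toNNReal
  have hms : w.measure = volume.withDensity fun z => ((w.toFun z).toNNReal : ENNReal) := rfl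
  have hpt : ∀ z, (w.toFun z).toNNReal • ((g (imPart z) * (laplaceTransform t φ z / h z))
        * (starRingEnd ℂ) (laplaceTransform t ψ z / h z))
      = g (imPart z) * ((laplaceTransform t φ z * (starRingEnd ℂ) (laplaceTransform t ψ z))
        * (heatKernel (t / 2) (imPart z) : ℂ)) := by
    intro z
    have h0 := hw.ne_zero z
    have h0' : (starRingEnd ℂ) (h z) ≠ 0 := by simpa using h0
    rw [NNReal.smul_def, Real.coe_toNNReal _ (w.pos_toFun z).le, hw.toFun_eq, Complex.real_smul]
    push_cast
    rw [← Complex.mul_conj', map_div₀]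
    field_simp
  rw [hms, integrable_withDensity_iff_integrable_smul hwm] at hI
  rw [hms, integral_withDensity_eq_integral_smul hwm]
  simp only [hpt] at hI ⊢
  rw [← hmp.integral_comp (complexPointEquiv n).measurableEmbedding]
  rw [← hmp.integrable_comp_emb (complexPointEquiv n).measurableEmbedding] at hI
  rw [Measure.volume_eq_prod] at hI ⊢
  rw [Function.comp_def] at hI
  rw [integral_prod_symm _ hI]
  simp only [complexPointEquiv_apply, imPart_complexPoint, integral_const_mul,
    integral_laplaceTransform_mul_heatKernel ht hφ hψ]
  simp only [← integral_const_mul]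
  exact (integral_integral_swap hjoint).trans
    (integral_congr_ae (Eventually.of_forall fun η => hflow η))

end BergmanWeight.IsTwist

/-! ### Gaussian mean values of entire functions -/

theorem integrable_gaussian_complex {c : ℝ} (hc : 0 < c) :
    Integrable fun v : Fin n → ℂ => Real.exp (-(c * ∑ i, ‖v i‖ ^ 2)) := by
  have h1 : Integrable fun z : ℂ => Real.exp (-(c * ‖z‖ ^ 2)) := by
    have := (GaussianFourier.integrable_cexp_neg_mul_sq_norm_add (V := ℂ) (b := (c : ℂ))
      (by simpa using hc) 0 0).norm
    refine this.congr (Eventually.of_forall fun z => ?_)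
    simp only [Complex.norm_exp, zero_mul, add_zero]
    rw [← Complex.ofReal_neg, ← Complex.ofReal_pow, ← Complex.ofReal_mul, Complex.ofReal_re]
    ring_nf
  refine (Integrable.fintype_prod (f := fun (_ : Fin n) (z : ℂ) => Real.exp (-(c * ‖z‖ ^ 2)))
    fun _ => h1).congr (Eventually.of_forall fun v => ?_)
  simp only [← Real.exp_sum, Finset.mul_sum, Finset.sum_neg_distrib]

theorem integral_gaussian_complex_pos {c : ℝ} (hc : 0 < c) :
    0 < ∫ v : Fin n → ℂ, Real.exp (-(c * ∑ i, ‖v i‖ ^ 2)) :=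
  integral_exp_pos (integrable_gaussian_complex hc)

/-- The mean value property of entire functions with respect to a centred Gaussian. -/
theorem integral_entire_mul_gaussian {c : ℝ} (F : (Fin n → ℂ) → ℂ)
    (hF : Differentiable ℂ F)
    (hint : Integrable fun v => F v * (Real.exp (-(c * ∑ i, ‖v i‖ ^ 2)) : ℂ)) :
    ∫ v, F v * (Real.exp (-(c * ∑ i, ‖v i‖ ^ 2)) : ℂ)
      = ((∫ v : Fin n → ℂ, Real.exp (-(c * ∑ i, ‖v i‖ ^ 2)) : ℝ) : ℂ) * F 0 := by
  set γ : (Fin n → ℂ) → ℝ := fun v => Real.exp (-(c * ∑ i, ‖v i‖ ^ 2)) with hγ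
  have hunit : ∀ θ : ℝ, ‖circleMap 0 1 θ‖ = 1 := fun θ => by simp
  have hemb : ∀ θ : ℝ, MeasurableEmbedding (fun v : Fin n → ℂ => circleMap 0 1 θ • v) := by
    intro θ
    have hc0 : circleMap 0 1 θ ≠ 0 := norm_ne_zero_iff.1 (by rw [hunit]; exact one_ne_zero)
    exact (Homeomorph.smulOfNeZero _ hc0).measurableEmbedding
  have hγr : ∀ θ v, γ (circleMap 0 1 θ • v) = γ v := by
    intro θ v
    simp only [hγ, Pi.smul_apply, norm_smul, hunit, one_mul]
  have hrot : ∀ θ : ℝ, ∫ v, F (circleMap 0 1 θ • v) * (γ v : ℂ) = ∫ v, F v * (γ v : ℂ) := by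
    intro θ
    have := (measurePreserving_smul_unit (n := n) _ (hunit θ)).integral_comp (hemb θ)
      (fun v => F v * (γ v : ℂ))
    simpa only [hγr] using this
  have hrotn : ∀ θ : ℝ, ∫ v, ‖F (circleMap 0 1 θ • v) * (γ v : ℂ)‖
      = ∫ v, ‖F v * (γ v : ℂ)‖ := by
    intro θ
    have := (measurePreserving_smul_unit (n := n) _ (hunit θ)).integral_comp (hemb θ)
      (fun v => ‖F v * (γ v : ℂ)‖)
    simpa only [hγr] using this
  have hroti : ∀ θ : ℝ, Integrable fun v => F (circleMap 0 1 θ • v) * (γ v : ℂ) := by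
    intro θ
    have := ((measurePreserving_smul_unit (n := n) _ (hunit θ)).integrable_comp_emb (hemb θ)
      (g := fun v => F v * (γ v : ℂ))).2 hint
    simpa only [Function.comp_def, hγr] using this
  have hmean : ∀ v, ∫ θ in (0)..(2 * Real.pi), F (circleMap 0 1 θ • v) * (γ v : ℂ)
      = (2 * Real.pi : ℂ) * (F 0 * γ v) := by
    intro v
    have hd : Differentiable ℂ (fun c : ℂ => F (c • v)) :=
      hF.comp (differentiable_id.smul_const v)
    have := circleAverage_of_differentiable_on_off_countable (c := 0) (R := 1)
      (f := fun c : ℂ => F (c • v)) Set.countable_empty hd.continuous.continuousOn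
      (fun x _ => hd x)
    rw [Real.circleAverage_def, inv_smul_eq_iff₀ (by positivity)] at this
    rw [intervalIntegral.integral_mul_const, this]
    simp
    ring
  have hcont : Continuous (fun p : ℝ × (Fin n → ℂ) =>
      F (circleMap 0 1 p.1 • p.2) * (γ p.2 : ℂ)) := by
    have h1 : Continuous (circleMap 0 1) := continuous_circleMap 0 1
    have h2 : Continuous γ := by fun_prop
    exact (hF.continuous.comp (by fun_prop)).mul (Complex.continuous_ofReal.comp (by fun_prop))
  -- By rotation invariance of the Gaussian the inner `L¹` norm does not depend on `θ`, which
  -- justifies Fubini.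
  have hswap : ∫ θ in (0)..(2 * Real.pi), ∫ v, F (circleMap 0 1 θ • v) * (γ v : ℂ)
      = ∫ v, ∫ θ in (0)..(2 * Real.pi), F (circleMap 0 1 θ • v) * (γ v : ℂ) := by
    simp only [intervalIntegral.integral_of_le (by positivity : (0:ℝ) ≤ 2 * Real.pi)]
    apply integral_integral_swap
    refine (integrable_prod_iff hcont.aestronglyMeasurable).2
      ⟨Eventually.of_forall fun θ => hroti θ, ?_⟩
    simp only [hrotn]
    exact integrable_const _
  simp only [hmean, hrot, intervalIntegral.integral_const, sub_zero, integral_const_mul] at hswap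
  have hpi : (2 * Real.pi : ℂ) ≠ 0 := by simp [Real.pi_ne_zero]
  rw [Complex.real_smul] at hswap
  push_cast at hswap
  rw [mul_left_cancel₀ hpi hswap, mul_comm, integral_complex_ofReal]

/-! ### The transform as a unitary map -/

theorem laplaceTransform_add {t : ℝ} (ht : 0 < t)
    (φ ψ : Lp ℂ 2 (volume : Measure (EuclideanSpace ℝ (Fin n)))) (z : Fin n → ℂ) :
    laplaceTransform t (φ + ψ : Lp ℂ 2 (volume : Measure (EuclideanSpace ℝ (Fin n)))) z
      = laplaceTransform t φ z + laplaceTransform t ψ z := by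
  rw [laplaceTransform, laplaceTransform, laplaceTransform,
    ← integral_add (integrable_mul_laplaceKernel ht (Lp.memLp φ) z)
      (integrable_mul_laplaceKernel ht (Lp.memLp ψ) z)]
  refine integral_congr_ae ?_
  filter_upwards [Lp.coeFn_add φ ψ] with η hη
  rw [hη, Pi.add_apply, add_mul]

theorem laplaceTransform_smul (t : ℝ) (c : ℂ)
    (φ : Lp ℂ 2 (volume : Measure (EuclideanSpace ℝ (Fin n)))) (z : Fin n → ℂ) :
    laplaceTransform t (c • φ : Lp ℂ 2 (volume : Measure (EuclideanSpace ℝ (Fin n)))) z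
      = c * laplaceTransform t φ z := by
  rw [laplaceTransform, laplaceTransform, ← integral_const_mul]
  refine integral_congr_ae ?_
  filter_upwards [Lp.coeFn_smul c φ] with η hη
  rw [hη, Pi.smul_apply, smul_eq_mul, mul_assoc]

theorem laplaceTransform_congr {t : ℝ} {φ ψ : EuclideanSpace ℝ (Fin n) → ℂ}
    (h : φ =ᵐ[volume] ψ) (z : Fin n → ℂ) :
    laplaceTransform t φ z = laplaceTransform t ψ z := by
  refine integral_congr_ae ?_
  filter_upwards [h] with η hη
  rw [hη]

/-- The exponents add, so the times add to `2t`. With `b` the conjugate of `a` this is, up to a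
constant and the twist, the reproducing kernel at `a`. -/
theorem laplaceTransform_laplaceKernel {t : ℝ} (ht : 0 < t) (b z : Fin n → ℂ) :
    laplaceTransform t (laplaceKernel t (-b)) z = complexHeatKernel (2 * t) (z - b) := by
  rw [← integral_laplaceKernel (by positivity), laplaceTransform]
  refine integral_congr_ae (Eventually.of_forall fun η => ?_)
  simp only [laplaceKernel, ← Complex.exp_add]
  congr 1
  simp only [Pi.neg_apply, Pi.sub_apply, Finset.mul_sum, ← Finset.sum_add_distrib]
  refine Finset.sum_congr rfl fun i _ => ?_
  push_cast
  ring

/-- Writing `Im z = (z - z̄)/(2i)`, the exponent separates into a polynomial holomorphic in `v` that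
vanishes at `v = 0`, and `-|v|²/(4t)`. -/
theorem conj_complexHeatKernel_mul_heatKernel {t : ℝ} (ht : 0 < t) (a v : Fin n → ℂ) :
    (starRingEnd ℂ) (complexHeatKernel (2 * t) (a + v - star a))
        * (heatKernel (t / 2) (imPart (a + v)) : ℂ)
      = (((4 * Real.pi * (2 * t)) ^ (-(n : ℝ) / 2) * (4 * Real.pi * (t / 2)) ^ (-(n : ℝ) / 2) : ℝ)
          : ℂ) *
        (Complex.exp ((∑ i, ((a i + v i) ^ 2 - a i ^ 2 - 2 * (starRingEnd ℂ) (a i) * v i)) / (8 * t))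
          * (Real.exp (-((4 * t)⁻¹ * ∑ i, ‖v i‖ ^ 2)) : ℂ)) := by
  have ht' : (t : ℂ) ≠ 0 := Complex.ofReal_ne_zero.2 ht.ne'
  have hnorm : ∀ i, ((imPart (a + v) i : ℝ) : ℂ)
      = ((a i + v i) - (starRingEnd ℂ) (a i + v i)) / (2 * Complex.I) := by
    intro i
    rw [Complex.sub_conj]
    simp [imPart]
    field_simp
  rw [complexHeatKernel, heatKernel, map_mul, Complex.conj_ofReal, ← Complex.exp_conj]
  push_cast
  rw [mul_mul_mul_comm]
  congr 1
  rw [← Complex.exp_add, ← Complex.exp_add, ← Complex.ofReal_pow, EuclideanSpace.norm_sq_eq]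
  congr 1
  simp only [Real.norm_eq_abs, sq_abs]
  push_cast
  simp only [hnorm, div_pow, mul_pow, Complex.I_sq, map_div₀, map_neg, map_sum, map_pow, map_mul,
    Complex.conj_ofReal, Complex.conj_ofNat, map_sub, map_add, ← Complex.mul_conj', Pi.add_apply,
    Pi.sub_apply, Pi.star_apply, RCLike.star_def, Complex.conj_conj]
  simp only [Finset.sum_div, Finset.mul_sum, ← Finset.sum_add_distrib, ← Finset.sum_neg_distrib]
  refine Finset.sum_congr rfl fun i _ => ?_
  field_simp
  ring

namespace BergmanWeight.IsTwist

variable {w : BergmanWeight n} {t : ℝ} {h : (Fin n → ℂ) → ℂ}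

/-- The isometry `φ ↦ laplaceTransform φ / h` of `L²(ℝⁿ)` into the weighted Bergman space. -/
noncomputable def isometry (hw : w.IsTwist t h) (ht : 0 < t) :
    Lp ℂ 2 (volume : Measure (EuclideanSpace ℝ (Fin n))) →ₗᵢ[ℂ] w.space where
  toFun φ := ⟨(hw.memLp_div ht (Lp.memLp φ)).toLp _,
    ⟨_, hw.differentiable_div ht (Lp.memLp φ), MemLp.coeFn_toLp _⟩⟩
  map_add' φ ψ := by
    ext1
    simp only [Submodule.coe_add]
    rw [← MemLp.toLp_add]
    congr 1
    ext z
    simp only [Pi.add_apply, laplaceTransform_add ht, add_div]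
  map_smul' c φ := by
    ext1
    simp only [Submodule.coe_smul, RingHom.id_apply]
    rw [← MemLp.toLp_const_smul]
    congr 1
    ext z
    simp only [Pi.smul_apply, laplaceTransform_smul, smul_eq_mul, mul_div_assoc]
  norm_map' φ := by
    change ‖(hw.memLp_div ht (Lp.memLp φ)).toLp _‖ = ‖φ‖
    rw [Lp.norm_toLp, hw.eLpNorm_div ht (Lp.memLp φ), Lp.norm_def]

theorem coeFn_isometry (hw : w.IsTwist t h) (ht : 0 < t)
    (φ : Lp ℂ 2 (volume : Measure (EuclideanSpace ℝ (Fin n)))) :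
    (hw.isometry ht φ : Lp ℂ 2 w.measure) =ᵐ[w.measure] fun z => laplaceTransform t φ z / h z :=
  MemLp.coeFn_toLp (hw.memLp_div ht (Lp.memLp φ))

/-- Orthogonality to the Gaussian attached to `a`, recentred at `a`, is the vanishing of the centred
Gaussian mean of an entire function `H` with `H 0 = G a * h a`. The mean value property and `h a ≠
0` give `G a = 0`. -/
theorem eq_zero_of_inner_isometry (hw : w.IsTwist t h) (ht : 0 < t) (F : w.space)
    (hF : ∀ φ, inner ℂ (hw.isometry ht φ) F = 0) : F = 0 := by
  obtain ⟨G, hG, hFG⟩ := F.2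
  suffices hz : ∀ a, G a = 0 by
    ext1
    rw [Submodule.coe_zero, Lp.eq_zero_iff_ae_eq_zero]
    exact hFG.trans (Eventually.of_forall hz)
  intro a
  have hk : MemLp (laplaceKernel t (-star a)) 2 := memLp_laplaceKernel ht _
  set φ := hk.toLp _ with hφ
  have hφW : (hw.isometry ht φ : Lp ℂ 2 w.measure) =ᵐ[w.measure]
      fun z => complexHeatKernel (2 * t) (z - star a) / h z := by
    filter_upwards [hw.coeFn_isometry ht φ] with z hz
    rw [hz, laplaceTransform_congr hk.coeFn_toLp, laplaceTransform_laplaceKernel ht]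
  have hL2 := (memLp_congr_ae hφW).1 (Lp.memLp _)
  have hI : Integrable (fun z => G z * (starRingEnd ℂ)
      (complexHeatKernel (2 * t) (z - star a) / h z)) w.measure :=
    ((memLp_congr_ae hFG).1 (Lp.memLp _)).integrable_mul hL2.star
  have h0 : ∫ z, G z * (starRingEnd ℂ)
      (complexHeatKernel (2 * t) (z - star a) / h z) ∂w.measure = 0 := by
    have h1 := hF φ
    rw [Submodule.coe_inner, L2.inner_def] at h1
    rw [← h1]
    refine integral_congr_ae ?_
    filter_upwards [hφW, hFG] with z hz hz'
    rw [RCLike.inner_apply, hz, hz']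
  have hwm : Measurable fun z => (w.toFun z).toNNReal :=
    w.continuous_toFun.measurable.real_toNNReal
  have hms : w.measure = volume.withDensity fun z => ((w.toFun z).toNNReal : ENNReal) := rfl
  rw [hms, integrable_withDensity_iff_integrable_smul hwm] at hI
  rw [hms, integral_withDensity_eq_integral_smul hwm] at h0
  set K : ℝ := (4 * Real.pi * (2 * t)) ^ (-(n : ℝ) / 2) * (4 * Real.pi * (t / 2)) ^ (-(n : ℝ) / 2)
    with hKdef
  have hK : K ≠ 0 := by positivity
  set H : (Fin n → ℂ) → ℂ := fun v => G (a + v) * h (a + v) *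
    Complex.exp ((∑ i, ((a i + v i) ^ 2 - a i ^ 2 - 2 * (starRingEnd ℂ) (a i) * v i)) / (8 * t))
    with hH
  have hpt : ∀ v, (w.toFun (a + v)).toNNReal • (G (a + v) * (starRingEnd ℂ)
      (complexHeatKernel (2 * t) (a + v - star a) / h (a + v)))
      = (K : ℂ) * (H v * (Real.exp (-((4 * t)⁻¹ * ∑ i, ‖v i‖ ^ 2)) : ℂ)) := by
    intro v
    have hne := hw.ne_zero (a + v)
    have hne' : (starRingEnd ℂ) (h (a + v)) ≠ 0 := by simpa using hne
    have hker := conj_complexHeatKernel_mul_heatKernel ht a v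
    rw [NNReal.smul_def, Real.coe_toNNReal _ (w.pos_toFun _).le, hw.toFun_eq, Complex.real_smul]
    push_cast
    rw [← Complex.mul_conj', map_div₀]
    calc _ = G (a + v) * h (a + v) * ((starRingEnd ℂ) (complexHeatKernel (2 * t) (a + v - star a))
        * (heatKernel (t / 2) (imPart (a + v)) : ℂ)) := by field_simp
      _ = _ := by
        rw [hker, ← hKdef]
        simp only [hH]
        push_cast
        ring
  have hI' := hI.comp_add_left a
  rw [← integral_add_left_eq_self _ a] at h0
  simp only [hpt] at hI' h0
  have hHd : Differentiable ℂ H := by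
    have hadd : Differentiable ℂ fun v : Fin n → ℂ => a + v :=
      (differentiable_const a).add differentiable_id
    refine ((hG.comp hadd).mul (hw.differentiable.comp hadd)).mul ?_
    fun_prop
  rw [integral_const_mul, integral_entire_mul_gaussian H hHd
    ((integrable_const_mul_iff (Ne.isUnit (Complex.ofReal_ne_zero.2 hK)) _).1 hI')] at h0
  have hγ : ((∫ v : Fin n → ℂ, Real.exp (-((4 * t)⁻¹ * ∑ i, ‖v i‖ ^ 2)) : ℝ) : ℂ) ≠ 0 :=
    Complex.ofReal_ne_zero.2 (integral_gaussian_complex_pos (by positivity)).ne'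
  have h2 := (mul_eq_zero.1 ((mul_eq_zero.1 h0).resolve_left
    (Complex.ofReal_ne_zero.2 hK))).resolve_left hγ
  simpa [hH, hw.ne_zero] using h2

/-- The range of an isometry from a complete space is closed, so a trivial orthogonal complement
suffices. -/
theorem isometry_surjective (hw : w.IsTwist t h) (ht : 0 < t) :
    Function.Surjective (hw.isometry ht) := by
  have hc : CompleteSpace (hw.isometry ht).toLinearMap.range :=
    ((hw.isometry ht).isometry.isUniformInducing.isComplete_range).completeSpace_coe
  rw [← LinearIsometry.coe_toLinearMap, ← LinearMap.range_eq_top,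
    ← Submodule.orthogonal_eq_bot_iff, Submodule.eq_bot_iff]
  intro F hF
  exact hw.eq_zero_of_inner_isometry ht F fun φ => hF _ ⟨φ, rfl⟩

/-- The unitary map `φ ↦ laplaceTransform φ / h` of `L²(ℝⁿ)` onto the weighted Bergman space. -/
noncomputable def unitary (hw : w.IsTwist t h) (ht : 0 < t) :
    Lp ℂ 2 (volume : Measure (EuclideanSpace ℝ (Fin n))) ≃ₗᵢ[ℂ] w.space :=
  LinearIsometryEquiv.ofSurjective (hw.isometry ht) (hw.isometry_surjective ht)

theorem coeFn_unitary (hw : w.IsTwist t h) (ht : 0 < t)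
    (φ : Lp ℂ 2 (volume : Measure (EuclideanSpace ℝ (Fin n)))) :
    (hw.unitary ht φ : Lp ℂ 2 w.measure) =ᵐ[w.measure] fun z => laplaceTransform t φ z / h z :=
  hw.coeFn_isometry ht φ

end BergmanWeight.IsTwist

/-! ### Finiteness and continuity of heat flows -/

/-- Translates of the heat kernel to points of a polytope are controlled by the translates to its
vertices. -/
theorem heatKernel_sub_le_sum {s : ℝ} (hs : 0 < s) (P : Finset (EuclideanSpace ℝ (Fin n)))
    {ξ : EuclideanSpace ℝ (Fin n)} (hξ : ξ ∈ convexHull ℝ (P : Set (EuclideanSpace ℝ (Fin n))))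
    (y : EuclideanSpace ℝ (Fin n)) :
    heatKernel s (ξ - y) ≤ ∑ p ∈ P, Real.exp (‖p‖ ^ 2 / (4 * s)) * heatKernel s (p - y) := by
  -- As a function of `ξ`, the translate is `exp(-‖ξ‖²/(4s)) ≤ 1` times the exponential of a linear
  -- functional, which on a polytope is largest at a vertex. The factor `exp(‖p‖²/(4s))` restores
  -- the Gaussian at that vertex.
  have hconv : ConvexOn ℝ Set.univ fun ξ : EuclideanSpace ℝ (Fin n) => inner ℝ y ξ :=
    (innerₗ _ y).convexOn convex_univ
  obtain ⟨p, hp, hle⟩ := hconv.exists_ge_of_mem_convexHull (Set.subset_univ _) hξ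
  have h1 : heatKernel s (ξ - y) ≤ Real.exp (‖p‖ ^ 2 / (4 * s)) * heatKernel s (p - y) := by
    rw [heatKernel, heatKernel, mul_left_comm, ← Real.exp_add]
    gcongr
    rw [← add_div]
    gcongr
    rw [norm_sub_sq_real, norm_sub_sq_real, real_inner_comm, real_inner_comm y p]
    nlinarith [sq_nonneg ‖ξ‖]
  refine h1.trans (Finset.single_le_sum
    (f := fun p => Real.exp (‖p‖ ^ 2 / (4 * s)) * heatKernel s (p - y)) (fun q _ => ?_) hp)
  exact mul_nonneg (Real.exp_pos _).le (heatKernel_pos hs _).le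

theorem continuous_heatKernel_sub (s : ℝ) (ξ : EuclideanSpace ℝ (Fin n)) :
    Continuous fun y => heatKernel s (ξ - y) :=
  (continuous_heatKernel s).comp (by fun_prop)

theorem lintegral_mul_heatKernel_lt_top_of_convexHull {s : ℝ} (hs : 0 < s)
    {k : EuclideanSpace ℝ (Fin n) → ENNReal} (hk : AEMeasurable k)
    (P : Finset (EuclideanSpace ℝ (Fin n)))
    (hP : ∀ p ∈ P, ∫⁻ y, k y * ENNReal.ofReal (heatKernel s (p - y)) < ⊤)
    {ξ : EuclideanSpace ℝ (Fin n)}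
    (hξ : ξ ∈ convexHull ℝ (P : Set (EuclideanSpace ℝ (Fin n)))) :
    ∫⁻ y, k y * ENNReal.ofReal (heatKernel s (ξ - y)) < ⊤ := by
  have hm : ∀ p, AEMeasurable fun y => k y * ENNReal.ofReal (heatKernel s (p - y)) := fun p =>
    hk.mul (continuous_heatKernel_sub s p).measurable.ennreal_ofReal.aemeasurable
  calc ∫⁻ y, k y * ENNReal.ofReal (heatKernel s (ξ - y))
      ≤ ∫⁻ y, ∑ p ∈ P, ENNReal.ofReal (Real.exp (‖p‖ ^ 2 / (4 * s))) *
          (k y * ENNReal.ofReal (heatKernel s (p - y))) := by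
        refine lintegral_mono fun y => ?_
        simp only [mul_left_comm _ (k y), ← Finset.mul_sum]
        gcongr
        rw [← Finset.sum_congr rfl fun p _ => ENNReal.ofReal_mul (Real.exp_pos _).le,
          ← ENNReal.ofReal_sum_of_nonneg fun p _ =>
            mul_nonneg (Real.exp_pos _).le (heatKernel_pos hs _).le]
        exact ENNReal.ofReal_le_ofReal (heatKernel_sub_le_sum hs P hξ y)
    _ = ∑ p ∈ P, ENNReal.ofReal (Real.exp (‖p‖ ^ 2 / (4 * s))) *
          ∫⁻ y, k y * ENNReal.ofReal (heatKernel s (p - y)) := by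
        rw [lintegral_finsetSum' _ fun p _ => (hm p).const_mul _]
        refine Finset.sum_congr rfl fun p _ => lintegral_const_mul'' _ (hm p)
    _ < ⊤ := ENNReal.sum_lt_top.2 fun p hp => ENNReal.mul_lt_top ENNReal.ofReal_lt_top (hP p hp)

/-- Reflection in `ξ` preserves null sets, so `ξ` is the midpoint of two points at which the
integral is finite. -/
theorem lintegral_mul_heatKernel_lt_top_of_ae {s c : ℝ} (hs : 0 < s) (hc : c ≠ 0)
    {k : EuclideanSpace ℝ (Fin n) → ENNReal} (hk : AEMeasurable k)
    (h : ∀ᵐ η, ∫⁻ y, k y * ENNReal.ofReal (heatKernel s (c • η - y)) < ⊤)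
    (ξ : EuclideanSpace ℝ (Fin n)) :
    ∫⁻ y, k y * ENNReal.ofReal (heatKernel s (ξ - y)) < ⊤ := by
  classical
  have h2 : ∀ᵐ η, ∫⁻ y, k y *
      ENNReal.ofReal (heatKernel s (c • (((2 * c⁻¹) • ξ) - η) - y)) < ⊤ :=
    (Measure.measurePreserving_sub_left volume ((2 * c⁻¹) • ξ)).quasiMeasurePreserving.ae h
  obtain ⟨η, h1, h2⟩ := (h.and h2).exists
  refine lintegral_mul_heatKernel_lt_top_of_convexHull hs hk
    {c • η, c • (((2 * c⁻¹) • ξ) - η)} ?_ ?_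
  · intro p hp
    rcases Finset.mem_insert.1 hp with rfl | hp
    · exact h1
    · rw [Finset.mem_singleton.1 hp]
      exact h2
  · rw [Finset.coe_insert, Finset.coe_singleton, convexHull_pair]
    refine ⟨1 / 2, 1 / 2, by norm_num, by norm_num, by norm_num, ?_⟩
    rw [smul_sub c, smul_smul c, mul_left_comm, mul_inv_cancel₀ hc]
    module

/-- Here `|g| ≤ |g|² + 1` and the heat kernel has total mass one. -/
theorem integrable_mul_heatKernel {s : ℝ} (hs : 0 < s) {g : EuclideanSpace ℝ (Fin n) → ℂ}
    (hg : AEMeasurable g) {ξ : EuclideanSpace ℝ (Fin n)}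
    (h : ∫⁻ y, ‖g y‖ₑ ^ 2 * ENNReal.ofReal (heatKernel s (ξ - y)) < ⊤) :
    Integrable fun y => g y * (heatKernel s (ξ - y) : ℂ) := by
  have hc := continuous_heatKernel_sub s ξ
  refine ⟨hg.aestronglyMeasurable.mul
    (Complex.continuous_ofReal.comp hc).aestronglyMeasurable, ?_⟩
  rw [hasFiniteIntegral_iff_enorm]
  refine lt_of_le_of_lt (lintegral_mono (g := fun y =>
    ‖g y‖ₑ ^ 2 * ENNReal.ofReal (heatKernel s (ξ - y)) + ENNReal.ofReal (heatKernel s (ξ - y)))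
    fun y => ?_) ((lintegral_add_right _ hc.measurable.ennreal_ofReal).trans_lt
      (ENNReal.add_lt_top.2 ⟨h, by rw [lintegral_heatKernel_sub hs]; exact ENNReal.one_lt_top⟩))
  have e : ‖(heatKernel s (ξ - y) : ℂ)‖ₑ = ENNReal.ofReal (heatKernel s (ξ - y)) := by
    rw [← ofReal_norm, Complex.norm_real, Real.norm_of_nonneg (heatKernel_pos hs _).le]
  simp only [enorm_mul, e]
  rw [← add_one_mul]
  gcongr
  rcases le_total ‖g y‖ₑ 1 with h1 | h1
  · exact h1.trans le_add_self
  · exact (le_self_pow₀ h1 two_ne_zero).trans le_self_add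

theorem continuous_heatFlow {s : ℝ} (hs : 0 < s) {g : EuclideanSpace ℝ (Fin n) → ℂ}
    (hg : ∀ ξ, Integrable fun y => g y * (heatKernel s (ξ - y) : ℂ)) :
    Continuous (heatFlow s g) := by
  classical
  rw [continuous_iff_continuousAt]
  intro ξ₀
  -- A simplex with `ξ₀` in its interior: its finitely many vertices give one integrable bound valid
  -- near `ξ₀`.
  obtain ⟨b, hb, -⟩ := exists_mem_interior_convexHull_affineBasis (s := Set.univ) (x := ξ₀) univ_mem
  have hP : Set.range b = (Finset.univ.image b : Finset (EuclideanSpace ℝ (Fin n))) := by simp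
  rw [hP, mem_interior_iff_mem_nhds] at hb
  set P := Finset.univ.image b
  refine continuousAt_of_dominated (bound := fun y => ∑ p ∈ P, Real.exp (‖p‖ ^ 2 / (4 * s)) *
    ‖g y * (heatKernel s (p - y) : ℂ)‖) (Eventually.of_forall fun ξ => (hg ξ).1) ?_
    (integrable_finsetSum _ fun p _ => (hg p).norm.const_mul _) ?_
  · filter_upwards [hb] with ξ hξ
    refine Eventually.of_forall fun y => ?_
    simp only [norm_mul, Complex.norm_real, Real.norm_of_nonneg (heatKernel_pos hs _).le,
      mul_left_comm _ ‖g y‖, ← Finset.mul_sum]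
    gcongr
    exact heatKernel_sub_le_sum hs P hξ y
  · refine Eventually.of_forall fun y => Continuous.continuousAt ?_
    exact continuous_const.mul (Complex.continuous_ofReal.comp
      ((continuous_heatKernel s).comp (by fun_prop)))

/-! ### Bounded multiplication operators on `L²` -/

theorem enorm_sq_eq_lintegral {α : Type*} [MeasurableSpace α] {μ : Measure α} (f : Lp ℂ 2 μ) :
    ‖f‖ₑ ^ 2 = ∫⁻ a, ‖f a‖ₑ ^ 2 ∂μ := by
  have := eLpNorm_nnreal_pow_eq_lintegral (μ := μ) (f := f) (p := 2) two_ne_zero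
  rw [Lp.enorm_def]
  simpa using this

/-- If multiplication by `m` is bounded by `C` on `L²`, then `|m| ≤ C` almost everywhere. -/
theorem ae_norm_le_of_norm_mul_le {α : Type*} [MeasurableSpace α] {μ : Measure α} [SigmaFinite μ]
    {m : α → ℂ} (hm : Measurable m) {C : ℝ} (hC : 0 ≤ C)
    (h : ∀ f : Lp ℂ 2 μ, ∃ f' : Lp ℂ 2 μ, ‖f'‖ ≤ C * ‖f‖ ∧ f' =ᵐ[μ] fun a => m a * f a) :
    ∀ᵐ a ∂μ, ‖m a‖ ≤ C := by
  have hle : (fun a => ‖m a‖ₑ ^ 2) ≤ᵐ[μ] fun _ => ENNReal.ofReal C ^ 2 := by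
    refine ae_le_of_forall_setLIntegral_le_of_sigmaFinite (hm.enorm.pow_const 2) fun A hA hAf => ?_
    obtain ⟨f', hf', hf'm⟩ := h (indicatorConstLp 2 hA hAf.ne 1)
    have h1 : ‖f'‖ₑ ≤ ENNReal.ofReal C * ‖indicatorConstLp 2 hA hAf.ne (1 : ℂ)‖ₑ := by
      rw [← ofReal_norm, ← ofReal_norm, ← ENNReal.ofReal_mul hC]
      exact ENNReal.ofReal_le_ofReal hf'
    have hind : ∫⁻ a, ‖(indicatorConstLp 2 hA hAf.ne (1 : ℂ) : Lp ℂ 2 μ) a‖ₑ ^ 2 ∂μ = μ A := by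
      refine (lintegral_congr_ae ?_).trans (lintegral_indicator_one hA)
      filter_upwards [indicatorConstLp_coeFn (p := 2) (hs := hA) (hμs := hAf.ne) (c := (1 : ℂ))]
        with a ha
      rw [ha]
      by_cases haA : a ∈ A <;> simp [haA]
    have hmul : ∫⁻ a, ‖f' a‖ₑ ^ 2 ∂μ = ∫⁻ a in A, ‖m a‖ₑ ^ 2 ∂μ := by
      rw [← lintegral_indicator hA]
      refine lintegral_congr_ae ?_
      filter_upwards [hf'm, indicatorConstLp_coeFn (p := 2) (hs := hA) (hμs := hAf.ne)
        (c := (1 : ℂ))] with a ha ha'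
      rw [ha, ha']
      by_cases haA : a ∈ A <;> simp [haA]
    rw [← hmul, ← enorm_sq_eq_lintegral, setLIntegral_const]
    calc ‖f'‖ₑ ^ 2 ≤ (ENNReal.ofReal C * ‖indicatorConstLp 2 hA hAf.ne (1 : ℂ)‖ₑ) ^ 2 := by
          gcongr
      _ = _ := by rw [mul_pow, enorm_sq_eq_lintegral, hind]
  filter_upwards [hle] with a ha
  have h2 := (ENNReal.pow_le_pow_left_iff two_ne_zero).1 ha
  rwa [← ofReal_norm, ENNReal.ofReal_le_ofReal_iff hC] at h2

/-- A dense subspace of `L²` has no common zero set of positive measure. -/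
theorem measure_eq_zero_of_dense {α : Type*} [MeasurableSpace α] {μ : Measure α} [SigmaFinite μ]
    {S : Set α} (hS : MeasurableSet S) {D : Set (Lp ℂ 2 μ)} (hD : Dense D)
    (h : ∀ f ∈ D, ∀ᵐ a ∂μ, a ∈ S → f a = 0) : μ S = 0 := by
  by_contra hne
  obtain ⟨A, hA, hAS, hA0, hAf⟩ := Measure.exists_subset_measure_lt_top hS (pos_iff_ne_zero.2 hne)
  have hz : indicatorConstLp 2 hA hAf.ne (1 : ℂ) = 0 := by
    refine hD.eq_zero_of_inner_left ℂ fun f hf => ?_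
    rw [L2.inner_indicatorConstLp_one]
    refine setIntegral_eq_zero_of_ae_eq_zero ?_
    filter_upwards [h f hf] with a ha haA
    exact ha (hAS haA)
  have h1 := norm_indicatorConstLp (p := 2) (hs := hA) (hμs := hAf.ne) (c := (1 : ℂ))
    (by simp) (by simp)
  rw [hz, norm_zero, norm_one, one_mul] at h1
  have h2 : 0 < μ.real A := ENNReal.toReal_pos hA0.ne' hAf.ne
  exact (Real.rpow_pos_of_pos h2 _).ne h1

/-! ### Toeplitz operators as multiplication operators -/

namespace BergmanWeight.IsTwist

variable {w : BergmanWeight n} {t : ℝ} {h : (Fin n → ℂ) → ℂ}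
  {g₀ : EuclideanSpace ℝ (Fin n) → ℂ} {D : Submodule ℂ w.space}

theorem coeFn_eq (hw : w.IsTwist t h) (ht : 0 < t) (F : w.space) :
    (F : Lp ℂ 2 w.measure) =ᵐ[w.measure]
      fun z => laplaceTransform t ((hw.unitary ht).symm F) z / h z := by
  have := hw.coeFn_unitary ht ((hw.unitary ht).symm F)
  rwa [LinearIsometryEquiv.apply_symm_apply] at this

/-- If `N` is the integral at `-4πtη`, then `N |φ|²` is integrable for every `φ` coming from `D`, so
`φ` vanishes almost everywhere on `{N = ⊤}`. Density of `D` makes this set null. -/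
theorem lintegral_symbol_lt_top (hw : w.IsTwist t h) (ht : 0 < t) (hg₀ : AEMeasurable g₀)
    (hD : Dense (D : Set w.space))
    (hgD : ∀ F ∈ D, MemLp (fun z => g₀ (imPart z) * (F : Lp ℂ 2 w.measure) z) 2 w.measure)
    (ξ : EuclideanSpace ℝ (Fin n)) :
    ∫⁻ y, ‖g₀ y‖ₑ ^ 2 * ENNReal.ofReal (heatKernel (t / 2) (ξ - y)) < ⊤ := by
  have hk : AEMeasurable fun y => ‖g₀ y‖ₑ ^ 2 := hg₀.enorm.pow_const 2
  have hc : -(4 * Real.pi * t) ≠ 0 := by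
    have := Real.pi_pos
    exact (neg_neg_of_pos (by positivity)).ne
  refine lintegral_mul_heatKernel_lt_top_of_ae (half_pos ht) hc hk ?_ ξ
  set N : EuclideanSpace ℝ (Fin n) → ENNReal := fun η => ∫⁻ y, ‖g₀ y‖ₑ ^ 2 *
    ENNReal.ofReal (heatKernel (t / 2) (-(4 * Real.pi * t) • η - y)) with hN
  -- As `g₀` is only almost everywhere measurable, a measurable representative is used; it leaves
  -- `N` unchanged at every point.
  have hNm : Measurable N := by
    have h1 : N = fun η => ∫⁻ y, hk.mk _ y *
        ENNReal.ofReal (heatKernel (t / 2) (-(4 * Real.pi * t) • η - y)) := by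
      funext η
      refine lintegral_congr_ae ?_
      filter_upwards [hk.ae_eq_mk] with y hy
      rw [hy]
    have h2 : Continuous fun p : EuclideanSpace ℝ (Fin n) × EuclideanSpace ℝ (Fin n) =>
        heatKernel (t / 2) (-(4 * Real.pi * t) • p.1 - p.2) :=
      (continuous_heatKernel _).comp (by fun_prop)
    rw [h1]
    exact ((hk.measurable_mk.comp measurable_snd).mul
      h2.measurable.ennreal_ofReal).lintegral_prod_right'
  have hS : MeasurableSet {η | N η = ⊤} := hNm (measurableSet_singleton ⊤)
  have h0 : volume {η | N η = ⊤} = 0 := by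
    refine measure_eq_zero_of_dense hS (D := (hw.unitary ht).symm '' D) ?_ ?_
    · exact (hw.unitary ht).symm.surjective.denseRange.dense_image
        (hw.unitary ht).symm.continuous hD
    · rintro _ ⟨F, hF, rfl⟩
      set φ := (hw.unitary ht).symm F
      have h1 := hw.lintegral_measure_eq ht (Lp.memLp φ) hk
      have h2 : ∫⁻ z, ‖g₀ (imPart z)‖ₑ ^ 2 * ‖laplaceTransform t φ z / h z‖ₑ ^ 2 ∂w.measure < ⊤ := by
        have h3 := (memLp_two_iff_lintegral_lt_top (hgD F hF).1).1 (hgD F hF)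
        refine lt_of_eq_of_lt (lintegral_congr_ae ?_) h3
        filter_upwards [hw.coeFn_eq ht F] with z hz
        rw [hz, enorm_mul, mul_pow]
      rw [h1] at h2
      have h4 := ae_lt_top' (hNm.aemeasurable.mul ((Lp.memLp φ).1.enorm.pow_const 2)) h2.ne
      filter_upwards [h4] with η hη hηN
      by_contra hφ
      have hηN' : N η = ⊤ := hηN
      simp only [Pi.mul_apply, hηN'] at hη
      rw [ENNReal.top_mul (by simpa using hφ)] at hη
      exact hη.ne rfl
  rw [ae_iff]
  convert h0 using 3
  simp [hN]

/-- Both sides have the same integral over every set `A` of finite measure: take `ψ` to be the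
indicator of `A` in the bilinear identity. -/
theorem toeplitz_ae_eq (hw : w.IsTwist t h) (ht : 0 < t) (hg₀ : AEMeasurable g₀)
    (hgD : ∀ F ∈ D, MemLp (fun z => g₀ (imPart z) * (F : Lp ℂ 2 w.measure) z) 2 w.measure)
    (F : D) :
    ((hw.unitary ht).symm (w.toeplitz (fun z => g₀ (imPart z)) D hgD F) :
        EuclideanSpace ℝ (Fin n) → ℂ)
      =ᵐ[volume] fun η => heatFlow (t / 2) g₀ (-(4 * Real.pi * t) • η) *
        (hw.unitary ht).symm (F : w.space) η := by
  set φ := (hw.unitary ht).symm (F : w.space) with hφ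
  have hgF := hgD F F.2
  have hgφ : MemLp (fun z => g₀ (imPart z) * (laplaceTransform t φ z / h z)) 2 w.measure := by
    refine (memLp_congr_ae ?_).1 hgF
    filter_upwards [hw.coeFn_eq ht (F : w.space)] with z hz
    rw [hz]
  have key : ∀ A : Set (EuclideanSpace ℝ (Fin n)), MeasurableSet A → volume A < ⊤ →
      IntegrableOn (fun η => heatFlow (t / 2) g₀ (-(4 * Real.pi * t) • η) * φ η) A ∧
      ∫ η in A, (hw.unitary ht).symm (w.toeplitz (fun z => g₀ (imPart z)) D hgD F) η
        = ∫ η in A, heatFlow (t / 2) g₀ (-(4 * Real.pi * t) • η) * φ η := by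
    intro A hA hAf
    set ψ : Lp ℂ 2 (volume : Measure (EuclideanSpace ℝ (Fin n))) :=
      indicatorConstLp 2 hA hAf.ne 1 with hψ
    obtain ⟨h1, h2⟩ := hw.integral_measure_eq ht (Lp.memLp φ) (Lp.memLp ψ) hg₀ hgφ
    have hind : (fun η => heatFlow (t / 2) g₀ (-(4 * Real.pi * t) • η) *
        (φ η * (starRingEnd ℂ) (ψ η))) =ᵐ[volume]
        A.indicator fun η => heatFlow (t / 2) g₀ (-(4 * Real.pi * t) • η) * φ η := by
      filter_upwards [indicatorConstLp_coeFn (p := 2) (hs := hA) (hμs := hAf.ne) (c := (1 : ℂ))]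
        with η hη
      rw [hψ, hη]
      by_cases hηA : η ∈ A <;> simp [hηA]
    refine ⟨(integrable_indicator_iff hA).1 (h1.congr hind), ?_⟩
    rw [← integral_indicator hA, ← integral_indicator hA, ← integral_congr_ae hind, ← h2,
      integral_indicator hA, ← L2.inner_indicatorConstLp_one (𝕜 := ℂ) hA hAf.ne, ← hψ,
      ← LinearIsometryEquiv.inner_map_map (hw.unitary ht), LinearIsometryEquiv.apply_symm_apply]
    -- The projection disappears because the other argument already lies in the Bergman space.
    refine (Submodule.inner_orthogonalProjectionOnto_eq_of_mem_left _ _).trans ?_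
    rw [L2.inner_def]
    refine integral_congr_ae ?_
    filter_upwards [hw.coeFn_unitary ht ψ, hgF.coeFn_toLp, hw.coeFn_eq ht (F : w.space)]
      with z hz hz' hzF
    rw [RCLike.inner_apply, hz, hz', hzF]
  refine ae_eq_of_forall_setIntegral_eq_of_sigmaFinite (fun A hA hAf => ?_)
    (fun A hA hAf => (key A hA hAf).1) fun A hA hAf => (key A hA hAf).2
  exact integrableOn_Lp_of_measure_ne_top _ one_le_two hAf.ne

theorem isBoundedOn_of_bounded (hw : w.IsTwist t h) (ht : 0 < t) (hg₀ : AEMeasurable g₀)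
    (hgD : ∀ F ∈ D, MemLp (fun z => g₀ (imPart z) * (F : Lp ℂ 2 w.measure) z) 2 w.measure)
    (hb : ∃ C : ℝ, ∀ ξ, ‖heatFlow (t / 2) g₀ ξ‖ ≤ C) :
    IsBoundedOn (w.toeplitz (fun z => g₀ (imPart z)) D hgD) := by
  obtain ⟨C, hC⟩ := hb
  refine ⟨C, fun F => ?_⟩
  rw [← (hw.unitary ht).symm.norm_map, Submodule.coe_norm,
    ← (hw.unitary ht).symm.norm_map (F : w.space)]
  refine Lp.norm_le_mul_norm_of_ae_le_mul ?_
  filter_upwards [hw.toeplitz_ae_eq ht hg₀ hgD F] with η hη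
  rw [hη, norm_mul]
  gcongr
  exact hC _

/-- The multiplication formula survives the extension by density: `L²` convergence gives almost
everywhere convergence along a common subsequence. -/
theorem exists_extension (hw : w.IsTwist t h) (ht : 0 < t) (hg₀ : AEMeasurable g₀)
    (hD : Dense (D : Set w.space))
    (hgD : ∀ F ∈ D, MemLp (fun z => g₀ (imPart z) * (F : Lp ℂ 2 w.measure) z) 2 w.measure)
    (hb : IsBoundedOn (w.toeplitz (fun z => g₀ (imPart z)) D hgD)) :
    ∃ T : w.space →L[ℂ] w.space,
      (∀ F : D, T F = w.toeplitz (fun z => g₀ (imPart z)) D hgD F) ∧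
      ∀ F : w.space, ((hw.unitary ht).symm (T F) : EuclideanSpace ℝ (Fin n) → ℂ)
        =ᵐ[volume] fun η => heatFlow (t / 2) g₀ (-(4 * Real.pi * t) • η) *
          (hw.unitary ht).symm F η := by
  set T₀ := LinearMap.mkContinuousOfExistsBound (w.toeplitz (fun z => g₀ (imPart z)) D hgD) hb
  have hDr : DenseRange D.subtypeL := by
    rw [DenseRange, Submodule.coe_subtypeL, Submodule.coe_subtype, Subtype.range_coe]
    exact hD
  have hext : ∀ F : D, T₀.extend D.subtypeL F = w.toeplitz (fun z => g₀ (imPart z)) D hgD F :=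
    fun F => ContinuousLinearMap.extend_eq T₀ hDr (isUniformInducing_val _) F
  set T := T₀.extend D.subtypeL
  refine ⟨T, hext, fun F => ?_⟩
  obtain ⟨u, huD, hu⟩ := mem_closure_iff_seq_limit.1 (hD F)
  have h1 : Tendsto (fun k => (hw.unitary ht).symm (u k)) atTop (𝓝 ((hw.unitary ht).symm F)) :=
    ((hw.unitary ht).symm.continuous.tendsto F).comp hu
  have h2 : Tendsto (fun k => (hw.unitary ht).symm (T (u k))) atTop
      (𝓝 ((hw.unitary ht).symm (T F))) :=
    (((hw.unitary ht).symm.continuous.comp T.continuous).tendsto F).comp hu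
  obtain ⟨a, ha, hae⟩ := (tendstoInMeasure_of_tendsto_Lp h1).exists_seq_tendsto_ae
  obtain ⟨b, hb, hbe⟩ :=
    (tendstoInMeasure_of_tendsto_Lp (h2.comp ha.tendsto_atTop)).exists_seq_tendsto_ae
  have hk : ∀ k, ((hw.unitary ht).symm (T (u k)) : EuclideanSpace ℝ (Fin n) → ℂ)
      =ᵐ[volume] fun η => heatFlow (t / 2) g₀ (-(4 * Real.pi * t) • η) *
          (hw.unitary ht).symm (u k) η := by
    intro k
    have := hw.toeplitz_ae_eq ht hg₀ hgD ⟨u k, huD k⟩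
    rwa [← hext ⟨u k, huD k⟩] at this
  filter_upwards [hae, hbe, ae_all_iff.2 hk] with η h1 h2 h3
  refine tendsto_nhds_unique h2 ?_
  simp only [Function.comp_apply, h3]
  exact (h1.comp hb.tendsto_atTop).const_mul _

/-- Boundedness gives `|m| ≤ ‖T‖` almost everywhere. By continuity of the flow this is a closed
condition, and a set of full measure is dense, so it holds everywhere. -/
theorem bounded_of_isBoundedOn (hw : w.IsTwist t h) (ht : 0 < t) (hg₀ : AEMeasurable g₀)
    (hD : Dense (D : Set w.space))
    (hgD : ∀ F ∈ D, MemLp (fun z => g₀ (imPart z) * (F : Lp ℂ 2 w.measure) z) 2 w.measure)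
    (hb : IsBoundedOn (w.toeplitz (fun z => g₀ (imPart z)) D hgD)) :
    ∃ C : ℝ, ∀ ξ, ‖heatFlow (t / 2) g₀ ξ‖ ≤ C := by
  obtain ⟨T, -, hT⟩ := hw.exists_extension ht hg₀ hD hgD hb
  have hcont : Continuous fun η => heatFlow (t / 2) g₀ (-(4 * Real.pi * t) • η) :=
    (continuous_heatFlow (half_pos ht) fun ξ => integrable_mul_heatKernel (half_pos ht) hg₀
      (hw.lintegral_symbol_lt_top ht hg₀ hD hgD ξ)).comp (by fun_prop)
  have hae : ∀ᵐ η, ‖heatFlow (t / 2) g₀ (-(4 * Real.pi * t) • η)‖ ≤ ‖T‖ := by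
    refine ae_norm_le_of_norm_mul_le hcont.measurable (norm_nonneg T) fun f =>
      ⟨(hw.unitary ht).symm (T (hw.unitary ht f)), ?_, ?_⟩
    · rw [LinearIsometryEquiv.norm_map]
      exact (T.le_opNorm _).trans_eq (by rw [LinearIsometryEquiv.norm_map])
    · have := hT (hw.unitary ht f)
      rwa [LinearIsometryEquiv.symm_apply_apply] at this
  have hcl : IsClosed {η | ‖heatFlow (t / 2) g₀ (-(4 * Real.pi * t) • η)‖ ≤ ‖T‖} :=
    isClosed_le hcont.norm continuous_const
  have huniv := hcl.closure_eq.symm.trans (Measure.dense_of_ae hae).closure_eq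
  refine ⟨‖T‖, fun ξ => ?_⟩
  have hc : -(4 * Real.pi * t) ≠ 0 := by
    have := Real.pi_pos
    exact (neg_neg_of_pos (by positivity)).ne
  have hmem : (-(4 * Real.pi * t))⁻¹ • ξ ∈
      {η | ‖heatFlow (t / 2) g₀ (-(4 * Real.pi * t) • η)‖ ≤ ‖T‖} := huniv ▸ Set.mem_univ _
  simpa only [Set.mem_ofPred_eq, smul_inv_smul₀ hc] using hmem

end BergmanWeight.IsTwist

/-! ### The Segal–Bargmann and Fock weights -/

theorem isTwist_segalBargmannWeight (n : ℕ) (t : ℝ) (ht : 0 < t) :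
    (segalBargmannWeight n t ht).IsTwist t fun _ => 1 where
  differentiable := differentiable_const 1
  ne_zero _ := one_ne_zero
  toFun_eq z := by simp [segalBargmannWeight]

/-- From `|z|²/2 = Re(z₁² + ⋯ + zₙ²)/2 + |y|²`; the square root adjusts the normalising constants.
-/
theorem isTwist_fockWeight (n : ℕ) :
    (fockWeight n).IsTwist (1 / 2) fun z =>
      (Real.sqrt (((2 * Real.pi) ^ n)⁻¹ / (4 * Real.pi * (1 / 2 / 2)) ^ (-(n : ℝ) / 2)) : ℂ) *
        Complex.exp (-(∑ i, z i ^ 2) / 4) where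
  differentiable := by fun_prop
  ne_zero z := mul_ne_zero (Complex.ofReal_ne_zero.2 (by positivity)) (Complex.exp_ne_zero _)
  toFun_eq z := by
    have h1 : ‖Complex.exp (-(∑ i, z i ^ 2) / 4)‖ ^ 2
        = Real.exp (-(∑ i, ((z i).re ^ 2 - (z i).im ^ 2)) / 2) := by
      rw [Complex.norm_exp, ← Real.exp_nat_mul]
      congr 1
      have h4 : (-(∑ i, z i ^ 2) / 4 : ℂ).re = -(∑ i, ((z i).re ^ 2 - (z i).im ^ 2)) / 4 := by
        rw [Complex.div_ofNat_re, Complex.neg_re, Complex.re_sum]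
        congr 2
        refine Finset.sum_congr rfl fun i _ => ?_
        simp [pow_two]
      rw [h4]
      push_cast
      ring
    have hC : (0 : ℝ) < (4 * Real.pi * (1 / 2 / 2)) ^ (-(n : ℝ) / 2) := by positivity
    rw [norm_mul, mul_pow, h1, Complex.norm_real, Real.norm_of_nonneg (Real.sqrt_nonneg _),
      Real.sq_sqrt (by positivity), heatKernel, EuclideanSpace.norm_sq_eq, mul_mul_mul_comm,
      div_mul_cancel₀ _ hC.ne', ← Real.exp_add]
    simp only [fockWeight]
    congr 2
    simp only [imPart, Real.norm_eq_abs, sq_abs, ← Complex.normSq_eq_norm_sq, Complex.normSq_apply,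
      Finset.sum_sub_distrib, Finset.sum_add_distrib, ← pow_two]
    ring

/-! ### The heat flow on `ℂⁿ` of a function of the imaginary part -/

theorem heatKernelCn_complexPoint {s : ℝ} (hs : 0 < s) (x y : EuclideanSpace ℝ (Fin n)) :
    heatKernelCn s (complexPoint x y) = heatKernel s x * heatKernel s y := by
  have hpow : ((4 * Real.pi * s) ^ n)⁻¹
      = (4 * Real.pi * s) ^ (-(n : ℝ) / 2) * (4 * Real.pi * s) ^ (-(n : ℝ) / 2) := by
    rw [← Real.rpow_add (by positivity), add_halves, Real.rpow_neg (by positivity),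
      Real.rpow_natCast]
  rw [heatKernelCn, heatKernel, heatKernel, mul_mul_mul_comm, ← Real.exp_add, hpow]
  congr 2
  rw [← add_div, EuclideanSpace.norm_sq_eq, EuclideanSpace.norm_sq_eq]
  congr 1
  rw [← neg_add, ← Finset.sum_add_distrib]
  congr 1
  refine Finset.sum_congr rfl fun i _ => ?_
  rw [← Complex.normSq_eq_norm_sq, Complex.normSq_apply]
  simp [complexPoint]
  ring

theorem heatKernelCn_sub_complexPoint {s : ℝ} (hs : 0 < s) (z : Fin n → ℂ)
    (x y : EuclideanSpace ℝ (Fin n)) :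
    heatKernelCn s (z - complexPoint x y)
      = heatKernel s ((WithLp.toLp 2 fun i => (z i).re) - x) * heatKernel s (imPart z - y) := by
  rw [← heatKernelCn_complexPoint hs]
  congr 1
  funext i
  apply Complex.ext <;> simp [complexPoint, imPart]

theorem integrable_mul_heatKernelCn {s : ℝ} (hs : 0 < s) {g : EuclideanSpace ℝ (Fin n) → ℂ}
    (z : Fin n → ℂ) (hg : Integrable fun y => g y * (heatKernel s (imPart z - y) : ℂ)) :
    Integrable fun v => g (imPart v) * (heatKernelCn s (z - v) : ℂ) := by
  rw [← (measurePreserving_complexPointEquiv n).integrable_comp_emb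
    (complexPointEquiv n).measurableEmbedding]
  have h1 : Integrable fun x : EuclideanSpace ℝ (Fin n) =>
      (heatKernel s ((WithLp.toLp 2 fun i => (z i).re) - x) : ℂ) :=
    ((integrable_heatKernel hs).comp_sub_left _).ofReal
  refine (h1.mul_prod hg).congr (Eventually.of_forall fun p => ?_)
  simp only [Function.comp_apply, complexPointEquiv_apply, imPart_complexPoint,
    heatKernelCn_sub_complexPoint hs]
  push_cast
  ring

/-- The kernel on `ℂⁿ` factors, and its `x`-part integrates to one. The product formula for
integrals needs no integrability of `g`. -/
theorem heatFlowCn_imPart {s : ℝ} (hs : 0 < s) (g : EuclideanSpace ℝ (Fin n) → ℂ)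
    (z : Fin n → ℂ) :
    heatFlowCn s (fun v => g (imPart v)) z = heatFlow s g (imPart z) := by
  rw [heatFlowCn, ← (measurePreserving_complexPointEquiv n).integral_comp
    (complexPointEquiv n).measurableEmbedding, Measure.volume_eq_prod]
  have h1 : ∀ p : EuclideanSpace ℝ (Fin n) × EuclideanSpace ℝ (Fin n),
      g (imPart (complexPointEquiv n p)) * (heatKernelCn s (z - complexPointEquiv n p) : ℂ)
      = (heatKernel s ((WithLp.toLp 2 fun i => (z i).re) - p.1) : ℂ)
        * (g p.2 * (heatKernel s (imPart z - p.2) : ℂ)) := by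
    intro p
    simp only [complexPointEquiv_apply, imPart_complexPoint, heatKernelCn_sub_complexPoint hs]
    push_cast
    ring
  simp only [h1]
  rw [integral_prod_mul (fun x => (heatKernel s ((WithLp.toLp 2 fun i => (z i).re) - x) : ℂ))
    (fun y => g y * (heatKernel s (imPart z - y) : ℂ)), integral_complex_ofReal,
    integral_heatKernel_sub hs, Complex.ofReal_one, one_mul, heatFlow]

/-- Toeplitz operators with symbol `g(x + iy) = g₀(y)`, defined on any dense subspace `D` on which
multiplication by `g` maps into `L²`: on the Segal–Bargmann space `B_t(ℂⁿ)` (boundedness and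
conjugacy to a Fourier multiplier through the Segal–Bargmann transform `U`), and on the Fock
space `F(ℂⁿ)`. -/
theorem theorem2p4 (n : ℕ) (t : ℝ) (ht : 0 < t)
    (g₀ : EuclideanSpace ℝ (Fin n) → ℂ) (hg₀ : AEMeasurable g₀ volume) :
    (∃ U : Lp ℂ 2 (volume : Measure (EuclideanSpace ℝ (Fin n))) ≃ₗᵢ[ℂ] SegalBargmannSpace n t ht,
      (∀ f, (U f : Lp ℂ 2 (segalBargmannWeight n t ht).measure)
          =ᵐ[(segalBargmannWeight n t ht).measure] segalBargmannTransform t f) ∧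
      ∀ (D : Submodule ℂ (SegalBargmannSpace n t ht))
        (_ : Dense (D : Set (SegalBargmannSpace n t ht)))
        (hgD : ∀ F ∈ D, MemLp (fun z => g₀ (imPart z) *
          (F : Lp ℂ 2 (segalBargmannWeight n t ht).measure) z) 2
            (segalBargmannWeight n t ht).measure),
        (∀ ξ, Integrable fun y => g₀ y * (heatKernel (t / 2) (ξ - y) : ℂ)) ∧
        (IsBoundedOn ((segalBargmannWeight n t ht).toeplitz (fun z => g₀ (imPart z)) D hgD) ↔
          ∃ C : ℝ, ∀ ξ, ‖heatFlow (t / 2) g₀ ξ‖ ≤ C) ∧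
        (IsBoundedOn ((segalBargmannWeight n t ht).toeplitz (fun z => g₀ (imPart z)) D hgD) →
          ∃ T : SegalBargmannSpace n t ht →L[ℂ] SegalBargmannSpace n t ht,
            (∀ F : D, T F =
              (segalBargmannWeight n t ht).toeplitz (fun z => g₀ (imPart z)) D hgD F) ∧
            IsFourierMultiplier
              ((U.symm : SegalBargmannSpace n t ht →L[ℂ]
                  Lp ℂ 2 (volume : Measure (EuclideanSpace ℝ (Fin n)))) ∘L T ∘L
                (U : Lp ℂ 2 (volume : Measure (EuclideanSpace ℝ (Fin n))) →L[ℂ]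
                  SegalBargmannSpace n t ht))
              (toeplitzMultiplier t g₀))) ∧
    (∀ (D : Submodule ℂ (FockSpace n)) (_ : Dense (D : Set (FockSpace n)))
      (hgD : ∀ F ∈ D, MemLp (fun z => g₀ (imPart z) *
        (F : Lp ℂ 2 (fockWeight n).measure) z) 2 (fockWeight n).measure),
      (∀ z : Fin n → ℂ,
        Integrable fun v => g₀ (imPart v) * (heatKernelCn (1 / 4) (z - v) : ℂ)) ∧
      (IsBoundedOn ((fockWeight n).toeplitz (fun z => g₀ (imPart z)) D hgD) ↔
        ∃ C : ℝ, ∀ z, ‖heatFlowCn (1 / 4) (fun v => g₀ (imPart v)) z‖ ≤ C)) := by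
  refine ⟨?_, ?_⟩
  · have hw := isTwist_segalBargmannWeight n t ht
    refine ⟨(Lp.fourierTransformₗᵢ (EuclideanSpace ℝ (Fin n)) ℂ).trans (hw.unitary ht),
      fun f => ?_, fun D hD hgD => ⟨fun ξ => integrable_mul_heatKernel (half_pos ht) hg₀
        (hw.lintegral_symbol_lt_top ht hg₀ hD hgD ξ),
        ⟨hw.bounded_of_isBoundedOn ht hg₀ hD hgD, hw.isBoundedOn_of_bounded ht hg₀ hgD⟩,
        fun hb => ?_⟩⟩
    · filter_upwards [hw.coeFn_unitary ht (𝓕 f)] with z hz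
      rw [segalBargmannTransform_eq_laplaceTransform ht, ← div_one (laplaceTransform _ _ _)]
      exact hz
    · obtain ⟨T, hTD, hT⟩ := hw.exists_extension ht hg₀ hD hgD hb
      refine ⟨T, hTD, fun f => ?_⟩
      have h1 := hT (hw.unitary ht (𝓕 f))
      rw [LinearIsometryEquiv.symm_apply_apply] at h1
      -- `U` is the Fourier transform followed by `hw.unitary`, so `U⁻¹` ends with `𝓕⁻`, which the
      -- outer `𝓕` undoes.
      have h2 : (𝓕 (𝓕⁻ ((hw.unitary ht).symm (T (hw.unitary ht (𝓕 f)))) :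
          Lp ℂ 2 (volume : Measure (EuclideanSpace ℝ (Fin n)))) :
          Lp ℂ 2 (volume : Measure (EuclideanSpace ℝ (Fin n))))
          = (hw.unitary ht).symm (T (hw.unitary ht (𝓕 f))) :=
        FourierTransform.fourier_fourierInv_eq _
      rw [← h2] at h1
      refine h1.trans (Eventually.of_forall fun η => ?_)
      simp only [toeplitzMultiplier, smul_smul]
      congr 3
      ring
  · intro D hD hgD
    have hw := isTwist_fockWeight n
    have ht' : (0 : ℝ) < 1 / 2 := by norm_num
    have hq : (1 / 2 / 2 : ℝ) = 1 / 4 := by norm_num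
    have hs : (0 : ℝ) < 1 / 4 := by norm_num
    refine ⟨fun z => integrable_mul_heatKernelCn hs z (integrable_mul_heatKernel hs hg₀ ?_), ?_⟩
    · have := hw.lintegral_symbol_lt_top ht' hg₀ hD hgD (imPart z)
      rwa [hq] at this
    · simp only [heatFlowCn_imPart hs]
      constructor
      · intro hb
        obtain ⟨C, hC⟩ := hw.bounded_of_isBoundedOn ht' hg₀ hD hgD hb
        rw [hq] at hC
        exact ⟨C, fun z => hC _⟩
      · rintro ⟨C, hC⟩
        refine hw.isBoundedOn_of_bounded ht' hg₀ hgD ⟨C, fun ξ => ?_⟩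
        rw [hq]
        -- Every `ξ` is the imaginary part of a point of `ℂⁿ`.
        simpa using hC (complexPoint 0 ξ)
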